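/- **Setting.** Let $\bar A\in\{0,\star\}^{n\times n}$ have a symmetric star pattern and let $\bar B\in\{0,\star\}^{n\times m}$. A numerical realization $(\tilde A,\tilde B)$ is a pair of real matrices obtained by assigning real numbers to the $\star$-entries, where the entries $(i,j)$ and $(j,i)$ of $\tilde A$ receive the same value (so $\tilde A=\tilde A^\top$) and all other parameters are independent. The stabilizable subspace of $(\tilde A,\tilde B)$ is the set of all $x(0)\in\mathbb R^n$ for which some input $u$ makes the solution of $\dot x=\tilde Ax+\tilde Bu$ satisfy $x(t)\to 0$ as $t\to\infty$; $\text{m-dim}(\bar A,\bar B)$ is the maximum of its dimension over all numerical realizations. The generic dimension of the controllable subspace is the number $d_c$ such that $\operatorname{rank}[\tilde B,\tilde A\tilde B,\dots,\tilde A^{n-1}\tilde B]=d_c$ for all parameter values outside some proper algebraic variety of the parameter space. The term rank $\text{t-rank}(\bar M)$ is the largest $k$ such that $\bar M$ has $k$ $\star$-entries in pairwise distinct rows and pairwise distinct columns. The pair $(\bar A,\bar B)$ is reducible if there is a permutation matrix $P$ with $$P\bar AP^\top=\begin{bmatrix}\bar A_{11}&0\\0&\bar A_{22}\end{bmatrix},\qquad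 P\bar B=\begin{bmatrix}\bar B_1\\0\end{bmatrix},\tag{$*$}$$ where $\bar A_{11}\in\{0,\star\}^{p\times p}$, $\bar B_1\in\{0,\star\}^{p\times m}$ and $0\le p<n$; otherwise it is irreducible. The digraph $\mathcal D(\bar A_{22})$ has the indices of $\bar A_{22}$ as vertices and an edge from $j$ to $i$ whenever $[\bar A_{22}]_{ij}=\star$. A directed cycle in it may have any length $|\mathcal C|\ge 1$ (self-loops have length $1$, and pairs of opposite edges have length $2$). A vertex set is independent if no edge joins two of its vertices and none of its vertices has a self-loop. A state $x_i$ is input-reachable if a directed path leads to it from some input, where there is an edge from $x_j$ to $x_i$ when $[\bar A]_{ij}=\star$ and from the input $u_j$ to $x_i$ when $[\bar B]_{ij}=\star$. **Theorem.** 1. If $(\bar A,\bar B)$ is irreducible, then the generic dimension of the controllable subspace of $(\bar A,\bar B)$ exists, is unique, and equals $\text{m-dim}(\bar A,\bar B)$. 2. If $(\bar A,\bar B)$ is reducible, then it can be permuted to the form $(*)$ in such a way that the indices of $\bar A_{11}$ are exactly the input-reachable states. For every such form and every finite family $\{\mathcal C_i\}_{i=1}^k$ of pairwise vertex-disjoint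 directed cycles in $\mathcal D(\bar A_{22})$, $$\text{m-dim}(\bar A,\bar B)\ \ge\ \text{t-rank}([\bar A_{11},\bar B_1])+\tfrac12\sum_{i:\,|\mathcal C_i|\text{ even}}|\mathcal C_i|+\tfrac12\sum_{i:\,|\mathcal C_i|\text{ odd}}(|\mathcal C_i|+1).$$ For every form $(*)$ and every independent set $\mathcal S$ of maximum cardinality in $\mathcal D(\bar A_{22})$, $$\text{m-dim}(\bar A,\bar B)\ \le\ \text{t-rank}([\bar A_{11},\bar B_1])+(n-p)-|\mathcal S|.$$ -/

import Mathlib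

open Filter Topology MeasureTheory

noncomputable section

namespace StructSys

/-! ### Structured matrices and their numerical realizations -/

/-- An entry of a structured matrix: a fixed zero or a free parameter. -/
inductive Entry where
  | zero : Entry
  | star : Entry

instance : Zero Entry := ⟨Entry.zero⟩

variable {ι κ : Type*}

/-- The independent parameters of a structured matrix: one for each star. -/
abbrev Param (M : Matrix ι κ Entry) : Type _ := {e : ι × κ // M e.1 e.2 = Entry.star}

/-- The independent parameters of a symmetrically structured matrix: one for each unordered pair
`{i, j}` of indices (possibly `i = j`) that carries a star, so that the entries `(i, j)` and
`(j, i)` share their parameter. -/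
abbrev SymParam (M : Matrix ι ι Entry) : Type _ :=
  {s : Sym2 ι // ∃ i j, s = s(i, j) ∧ M i j = Entry.star}

open Classical in
/-- The numerical realization of a structured matrix with parameter vector `p`. -/
def realize (M : Matrix ι κ Entry) (p : Param M → ℝ) : Matrix ι κ ℝ :=
  Matrix.of fun i j => if h : M i j = Entry.star then p ⟨(i, j), h⟩ else 0

open Classical in
/-- The numerical realization of a symmetrically structured matrix with parameter vector `p`. -/
def realizeSym (M : Matrix ι ι Entry) (p : SymParam M → ℝ) : Matrix ι ι ℝ :=
  Matrix.of fun i j => if h : M i j = Entry.star then p ⟨s(i, j), i, j, rfl, h⟩ else 0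

/-- The term rank: the largest `k` such that there are `k` distinct rows and `k` distinct columns,
paired so that all the corresponding entries are stars. -/
def tRank (M : Matrix ι κ Entry) : ℕ :=
  sSup {k | ∃ (r : Fin k ↪ ι) (c : Fin k ↪ κ), ∀ l, M (r l) (c l) = Entry.star}

theorem tRank_isGreatest [Finite ι] (M : Matrix ι κ Entry) :
    IsGreatest {k | ∃ (r : Fin k ↪ ι) (c : Fin k ↪ κ), ∀ l, M (r l) (c l) = Entry.star}
      (tRank M) := by
  have hb : BddAbove {k | ∃ (r : Fin k ↪ ι) (c : Fin k ↪ κ), ∀ l, M (r l) (c l) = Entry.star} := by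
    refine ⟨Nat.card ι, ?_⟩
    rintro k ⟨r, -, -⟩
    simpa using Nat.card_le_card_of_injective r r.injective
  have hne : {k | ∃ (r : Fin k ↪ ι) (c : Fin k ↪ κ), ∀ l, M (r l) (c l) = Entry.star}.Nonempty :=
    ⟨0, Function.Embedding.ofIsEmpty, Function.Embedding.ofIsEmpty, fun l => l.elim0⟩
  exact ⟨Nat.sSup_mem hne hb, fun k hk => le_csSup hb hk⟩

/-! ### Linear systems `x' = A x + B u` -/

variable {n m : ℕ}

/-- `x` is a trajectory on `[0, ∞)` of `x' = A x + B u` for the locally integrable input `u`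
(a solution in the sense of Carathéodory, that is, of the integrated equation). -/
structure IsTrajectory (A : Matrix (Fin n) (Fin n) ℝ) (B : Matrix (Fin n) (Fin m) ℝ)
    (u : ℝ → Fin m → ℝ) (x : ℝ → Fin n → ℝ) : Prop where
  input_integrable : ∀ t, 0 ≤ t → IntervalIntegrable u volume 0 t
  continuousOn : ContinuousOn x (Set.Ici 0)
  eq_integral : ∀ t, 0 ≤ t → x t = x 0 + ∫ s in (0 : ℝ)..t, (A.mulVec (x s) + B.mulVec (u s))

theorem IsTrajectory.integrable {A : Matrix (Fin n) (Fin n) ℝ} {B : Matrix (Fin n) (Fin m) ℝ}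
    {u : ℝ → Fin m → ℝ} {x : ℝ → Fin n → ℝ} (h : IsTrajectory A B u x) (t : ℝ) (ht : 0 ≤ t) :
    IntervalIntegrable (fun s => A.mulVec (x s) + B.mulVec (u s)) volume 0 t := by
  have hx : IntervalIntegrable x volume 0 t :=
    (h.continuousOn.mono (by rw [Set.uIcc_of_le ht]; exact Set.Icc_subset_Ici_self)
      ).intervalIntegrable
  have hu := h.input_integrable t ht
  have h1 := (LinearMap.toContinuousLinearMap A.mulVecLin).integrable_comp hx.1
  have h2 := (LinearMap.toContinuousLinearMap B.mulVecLin).integrable_comp hu.1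
  rw [intervalIntegrable_iff_integrableOn_Ioc_of_le ht]
  exact h1.add h2

theorem IsTrajectory.add {A : Matrix (Fin n) (Fin n) ℝ} {B : Matrix (Fin n) (Fin m) ℝ}
    {u v : ℝ → Fin m → ℝ} {x y : ℝ → Fin n → ℝ} (hx : IsTrajectory A B u x)
    (hy : IsTrajectory A B v y) : IsTrajectory A B (u + v) (x + y) where
  input_integrable t ht := (hx.input_integrable t ht).add (hy.input_integrable t ht)
  continuousOn := hx.continuousOn.add hy.continuousOn
  eq_integral t ht := by
    have e : (fun s => A.mulVec ((x + y) s) + B.mulVec ((u + v) s)) =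
        fun s => (A.mulVec (x s) + B.mulVec (u s)) + (A.mulVec (y s) + B.mulVec (v s)) := by
      funext s
      simp only [Pi.add_apply, Matrix.mulVec_add]
      abel
    rw [e, intervalIntegral.integral_add (hx.integrable t ht) (hy.integrable t ht)]
    simp only [Pi.add_apply]
    rw [hx.eq_integral t ht, hy.eq_integral t ht]
    abel

theorem IsTrajectory.smul {A : Matrix (Fin n) (Fin n) ℝ} {B : Matrix (Fin n) (Fin m) ℝ}
    {u : ℝ → Fin m → ℝ} {x : ℝ → Fin n → ℝ} (c : ℝ) (hx : IsTrajectory A B u x) :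
    IsTrajectory A B (c • u) (c • x) where
  input_integrable t ht := (hx.input_integrable t ht).smul c
  continuousOn := hx.continuousOn.const_smul c
  eq_integral t ht := by
    have e : (fun s => A.mulVec ((c • x) s) + B.mulVec ((c • u) s)) =
        fun s => c • (A.mulVec (x s) + B.mulVec (u s)) := by
      funext s
      simp only [Pi.smul_apply, Matrix.mulVec_smul, smul_add]
    rw [e, intervalIntegral.integral_smul]
    simp only [Pi.smul_apply]
    rw [hx.eq_integral t ht, smul_add]

/-- The stabilizable subspace of `(A, B)`: all initial states `x(0)` from which some input
drives the state to `0` as `t → ∞`. -/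
def stabilizableSubspace (A : Matrix (Fin n) (Fin n) ℝ) (B : Matrix (Fin n) (Fin m) ℝ) :
    Submodule ℝ (Fin n → ℝ) where
  carrier := {x₀ | ∃ u x, IsTrajectory A B u x ∧ x 0 = x₀ ∧ Tendsto x atTop (𝓝 0)}
  zero_mem' := by
    refine ⟨0, 0, ⟨fun t _ => ?_, continuousOn_const, fun t _ => ?_⟩, rfl, tendsto_const_nhds⟩
    · exact intervalIntegrable_const (c := (0 : Fin m → ℝ))
    · simp
  add_mem' := by
    rintro a b ⟨u, x, hx, rfl, hx0⟩ ⟨v, y, hy, rfl, hy0⟩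
    exact ⟨u + v, x + y, hx.add hy, rfl, by
      have h := hx0.add hy0
      rwa [add_zero] at h⟩
  smul_mem' := by
    rintro c a ⟨u, x, hx, rfl, hx0⟩
    exact ⟨c • u, c • x, hx.smul c, rfl, by
      have h := hx0.const_smul c
      rwa [smul_zero] at h⟩

/-- The controllability matrix `[B, A B, …, A ^ (n - 1) B]`. -/
def ctrbMatrix (A : Matrix (Fin n) (Fin n) ℝ) (B : Matrix (Fin n) (Fin m) ℝ) :
    Matrix (Fin n) (Fin n × Fin m) ℝ :=
  Matrix.of fun i kj => (A ^ (kj.1 : ℕ) * B) i kj.2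

/-! ### Structural pairs: maximal stabilizable and generic controllable dimension -/

/-- The dimensions of the stabilizable subspaces of all numerical realizations. -/
def stabDims (A : Matrix (Fin n) (Fin n) Entry) (B : Matrix (Fin n) (Fin m) Entry) : Set ℕ :=
  {d | ∃ (p : SymParam A → ℝ) (q : Param B → ℝ),
    d = Module.finrank ℝ (stabilizableSubspace (realizeSym A p) (realize B q))}

/-- The maximum dimension of the stabilizable subspace among all numerical realizations. -/
def mDim (A : Matrix (Fin n) (Fin n) Entry) (B : Matrix (Fin n) (Fin m) Entry) : ℕ :=
  sSup (stabDims A B)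

theorem mDim_isGreatest (A : Matrix (Fin n) (Fin n) Entry) (B : Matrix (Fin n) (Fin m) Entry) :
    IsGreatest (stabDims A B) (mDim A B) := by
  have hb : BddAbove (stabDims A B) := by
    refine ⟨n, ?_⟩
    rintro d ⟨p, q, rfl⟩
    simpa using (stabilizableSubspace (realizeSym A p) (realize B q)).finrank_le
  exact ⟨Nat.sSup_mem ⟨_, 0, 0, rfl⟩ hb, fun k hk => le_csSup hb hk⟩

/-- A variety in `ℝ^σ`: the common zero set of finitely many polynomials. -/
def IsVariety {σ : Type*} (V : Set (σ → ℝ)) : Prop :=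
  ∃ (k : ℕ) (φ : Fin k → MvPolynomial σ ℝ), V = {x | ∀ i, MvPolynomial.eval x (φ i) = 0}

/-- `d` is the generic dimension of the controllable subspace: outside a proper variety of the
space of all the independent parameters, the controllability matrix has rank `d`. -/
def IsGenericCtrbDim (A : Matrix (Fin n) (Fin n) Entry) (B : Matrix (Fin n) (Fin m) Entry)
    (d : ℕ) : Prop :=
  ∃ V : Set (SymParam A ⊕ Param B → ℝ), IsVariety V ∧ V ≠ Set.univ ∧
    ∀ (p : SymParam A → ℝ) (q : Param B → ℝ), Sum.elim p q ∉ V →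
      (ctrbMatrix (realizeSym A p) (realize B q)).rank = d

/-- The simultaneous permutation `e` brings `A` to the form `[[A₁₁, 0], [0, A₂₂]]` and `B` to the
form `[[B₁], [0]]`, where `A₁₁` is `p × p` and `A₂₂` is `q × q` with `p + q = n`, `q > 0`. -/
def IsBlockForm (A : Matrix (Fin n) (Fin n) Entry) (B : Matrix (Fin n) (Fin m) Entry) {p q : ℕ}
    (e : Fin n ≃ Fin p ⊕ Fin q) (A₁₁ : Matrix (Fin p) (Fin p) Entry)
    (A₂₂ : Matrix (Fin q) (Fin q) Entry) (B₁ : Matrix (Fin p) (Fin m) Entry) : Prop :=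
  0 < q ∧ Matrix.reindex e e A = Matrix.fromBlocks A₁₁ 0 0 A₂₂ ∧
    Matrix.reindex e (Equiv.refl (Fin m)) B = Matrix.fromRows B₁ 0

/-- A structural pair is irreducible if no permutation brings it to block form. -/
def IsIrreduciblePair (A : Matrix (Fin n) (Fin n) Entry) (B : Matrix (Fin n) (Fin m) Entry) :
    Prop :=
  ¬ ∃ (p q : ℕ) (e : Fin n ≃ Fin p ⊕ Fin q) (A₁₁ : Matrix (Fin p) (Fin p) Entry)
    (A₂₂ : Matrix (Fin q) (Fin q) Entry) (B₁ : Matrix (Fin p) (Fin m) Entry),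
    IsBlockForm A B e A₁₁ A₂₂ B₁

/-! ### Digraphs -/

/-- The state digraph: an edge from `j` to `i` for every star at `(i, j)`. -/
def stateDigraph (A : Matrix ι ι Entry) : Digraph ι where
  Adj j i := A i j = Entry.star

/-- The edges of the system digraph on state vertices `inl i` and input vertices `inr j`. -/
def SysAdj (A : Matrix ι ι Entry) (B : Matrix ι κ Entry) : ι ⊕ κ → ι ⊕ κ → Prop
  | .inl j, .inl i => A i j = Entry.star
  | .inr j, .inl i => B i j = Entry.star
  | _, .inr _ => False

/-- The digraph of a structural pair. -/
def sysDigraph (A : Matrix ι ι Entry) (B : Matrix ι κ Entry) : Digraph (ι ⊕ κ) where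
  Adj := SysAdj A B

/-- The state vertex `i` can be reached by a directed path from some input vertex. -/
def InputReachable (A : Matrix ι ι Entry) (B : Matrix ι κ Entry) (i : ι) : Prop :=
  ∃ j : κ, Relation.ReflTransGen (sysDigraph A B).Adj (Sum.inr j) (Sum.inl i)

/-- Independent vertex sets; in particular, no vertex of such a set carries a self-loop. -/
def IsIndep {V : Type*} (D : Digraph V) (S : Finset V) : Prop :=
  ∀ i ∈ S, ∀ j ∈ S, ¬ D.Adj i j

/-- Independent sets with the largest number of vertices. -/
def IsMaximumIndep {V : Type*} (D : Digraph V) (S : Finset V) : Prop :=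
  IsIndep D S ∧ ∀ T : Finset V, IsIndep D T → T.card ≤ S.card

/-- A directed cycle: distinct vertices, each with an edge to its cyclic successor. Length one is
a self-loop, and length two is a pair of opposite edges. -/
structure DCycle {V : Type*} (D : Digraph V) where
  /-- the number of vertices -/
  len : ℕ
  len_pos : 0 < len
  /-- the vertices in cyclic order -/
  vert : Fin len → V
  inj : Function.Injective vert
  adj : ∀ i, D.Adj (vert i) (vert (finRotate len i))

/-- Two cycles without a common vertex. -/
def DCycle.Disj {V : Type*} {D : Digraph V} (C C' : DCycle D) : Prop :=
  Disjoint (Set.range C.vert) (Set.range C'.vert)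

end StructSys

end

open StructSys

namespace StructSys

/-! ### Rank and nonvanishing minors -/

section Rank
variable {ι κ : Type*} [Fintype ι] [Fintype κ]

/-! The pivot is the term rank `t` of `[A, B]`. Any functional that kills the range of `[A, B]` is
constant along trajectories, so the stabilizable subspace lies in that range and has dimension at
most `t`. It also contains the controllable subspace. Both claims for irreducible pairs thus follow
once some realization has a controllability matrix of rank at least `t`: nonvanishing of a minor of
that matrix then gives rank exactly `t` generically.

Such a realization needs two facts. The first is that, despite the symmetry constraint, `[A, B]`
attains rank `t` (`exists_conforming_tRank_le_rank`). Take a realization of maximal rank whose left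
kernel has, among those, the largest coordinate support `I`. Perturbing one star at a time shows
that the columns with a star in a row of `I`, together with the rows outside `I`, form a cover of
all stars by at most rank many lines, as in König's theorem. The second is that, at algebraically
independent parameters, no eigenvector for a nonzero eigenvalue is orthogonal to the columns of `B`
(`eigenvector_eq_zero_of_vecMul_eq_zero`). Since `A` is diagonalizable, only kernel modes can then
be uncontrollable, and `[A, B]` and the controllability matrix have the same left kernel
(`rank_fromCols_le_rank_ctrbMatrix`).

For a reducible pair the stabilizable subspace splits along the blocks. The first block is treated
as above, and the second is an autonomous symmetric system, whose stabilizable subspace is governed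
by the quadratic form `xᵀAx`. An independent set spans an isotropic coordinate subspace, which meets
the stabilizable subspace only in `0`; this gives the upper bound. A subspace on which the form is
negative definite projects injectively to the negative eigenspaces; weighted cycles supply such
subspaces, which gives the lower bound. -/

theorem exists_linearIndependent_rows {K α β : Type*} [Field K] [Finite α] [Fintype β]
    (Z : Matrix α β K) : ∃ f : Fin Z.rank → α, LinearIndependent K (fun i => Z (f i)) := by
  rw [Matrix.rank_eq_finrank_span_row]
  obtain ⟨f, hf, -, hli⟩ := Submodule.exists_fun_fin_finrank_span_eq K (Set.range Z.row)
  choose g hg using hf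
  refine ⟨g, ?_⟩
  have : (fun i => Z (g i)) = f := funext hg
  rwa [this]

theorem exists_submatrix_det_ne_zero {K : Type*} [Field K] (X : Matrix ι κ K) :
    ∃ (r : Fin X.rank → ι) (c : Fin X.rank → κ), (X.submatrix r c).det ≠ 0 := by
  obtain ⟨r, hr⟩ := exists_linearIndependent_rows X
  have hrank : ((X.submatrix r id).transpose).rank = X.rank := by
    rw [Matrix.rank_transpose]
    simpa using LinearIndependent.rank_matrix (M := X.submatrix r id) hr
  obtain ⟨c, hc⟩ := exists_linearIndependent_rows ((X.submatrix r id).transpose)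
  refine ⟨r, c ∘ finCongr hrank.symm, ?_⟩
  have hli : LinearIndependent K (X.submatrix r (c ∘ finCongr hrank.symm)).transpose.row :=
    (hc.comp _ (finCongr hrank.symm).injective)
  have := Matrix.linearIndependent_rows_iff_isUnit.1 hli
  rw [Matrix.isUnit_iff_isUnit_det, Matrix.det_transpose] at this
  exact this.ne_zero

theorem le_rank_of_submatrix_det_ne_zero {K ι κ α : Type*} [Field K] [Fintype κ] [Fintype α]
    [DecidableEq α] (X : Matrix ι κ K) (r : α → ι) (c : α → κ) (h : (X.submatrix r c).det ≠ 0) :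
    Fintype.card α ≤ X.rank := by
  rw [← Matrix.rank_of_det_ne_zero h]
  exact Matrix.rank_submatrix_le X r c

end Rank

/-! ### Realizations as matrices conforming to a pattern -/

section Patterns
variable {ι κ : Type*}

/-- A real matrix conforms to a pattern if it vanishes outside the stars. -/
def Conforms (M : Matrix ι κ Entry) (X : Matrix ι κ ℝ) : Prop :=
  ∀ i j, M i j ≠ Entry.star → X i j = 0

theorem realize_conforms (M : Matrix ι κ Entry) (p : Param M → ℝ) : Conforms M (realize M p) := by
  intro i j h
  simp [realize, h]

theorem realizeSym_conforms (M : Matrix ι ι Entry) (p : SymParam M → ℝ) :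
    Conforms M (realizeSym M p) := by
  intro i j h
  simp [realizeSym, h]

theorem Conforms.exists_realize {M : Matrix ι κ Entry} {X : Matrix ι κ ℝ} (h : Conforms M X) :
    ∃ p, realize M p = X := by
  refine ⟨fun e => X e.1.1 e.1.2, ?_⟩
  ext i j
  by_cases hs : M i j = Entry.star
  · simp [realize, hs]
  · simp [realize, hs, h i j hs]

theorem realizeSym_isSymm {M : Matrix ι ι Entry} (hM : M.IsSymm) (p : SymParam M → ℝ) :
    (realizeSym M p).IsSymm := by
  ext i j
  have h : M j i = M i j := by rw [← hM.apply i j]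
  by_cases hs : M i j = Entry.star
  · simp [realizeSym, hs, h, Sym2.eq_swap]
  · simp [realizeSym, hs, h]

theorem Conforms.exists_realizeSym {M : Matrix ι ι Entry} {X : Matrix ι ι ℝ} (h : Conforms M X)
    (hX : X.IsSymm) : ∃ p, realizeSym M p = X := by
  refine ⟨fun e => Sym2.lift ⟨X, fun i j => (hX.apply j i)⟩ e.1, ?_⟩
  ext i j
  by_cases hs : M i j = Entry.star
  · simp [realizeSym, hs]
  · simp [realizeSym, hs, h i j hs]

theorem Conforms.fromCols {α : Type*} {M : Matrix ι κ Entry} {N : Matrix ι α Entry}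
    {X : Matrix ι κ ℝ} {Y : Matrix ι α ℝ} (hX : Conforms M X) (hY : Conforms N Y) :
    Conforms (Matrix.fromCols M N) (Matrix.fromCols X Y) := by
  rintro i (j | j) h
  · exact hX i j h
  · exact hY i j h

/-- A nonzero minor has a nonzero term in its Leibniz expansion, and the entries of that term are
stars in distinct rows and columns. -/
theorem Conforms.rank_le_tRank [Fintype ι] [Fintype κ] {M : Matrix ι κ Entry} {X : Matrix ι κ ℝ}
    (h : Conforms M X) : X.rank ≤ tRank M := by
  classical
  obtain ⟨r, c, hd⟩ := exists_submatrix_det_ne_zero X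
  have hr : Function.Injective r := by
    intro a b hab
    by_contra hne
    exact hd (Matrix.det_zero_of_row_eq hne (by ext j; simp [hab]))
  have hc : Function.Injective c := by
    intro a b hab
    by_contra hne
    exact hd (Matrix.det_zero_of_column_eq hne (by intro j; simp [hab]))
  rw [Matrix.det_apply] at hd
  obtain ⟨σ, -, hσ⟩ := Finset.exists_ne_zero_of_sum_ne_zero hd
  have hσ' : ∏ i, X (r (σ i)) (c i) ≠ 0 := by
    intro h0
    apply hσ
    simp only [Matrix.submatrix_apply, h0, smul_zero]
  rw [Finset.prod_ne_zero_iff] at hσ'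
  refine (tRank_isGreatest M).2 ⟨⟨r ∘ σ, hr.comp σ.injective⟩, ⟨c, hc⟩, fun l => ?_⟩
  by_contra hne
  exact hσ' l (Finset.mem_univ _) (h _ _ hne)

end Patterns

open Matrix

/-! ### Trajectories, and upper bounds on the stabilizable subspace -/

section Stabilizable
variable {n m : ℕ} {A : Matrix (Fin n) (Fin n) ℝ} {B : Matrix (Fin n) (Fin m) ℝ}

/-- The input `exp (-μt) w` keeps the state at `exp (-μt) z`. All stabilizable vectors constructed
below are obtained from such solutions by sums and limits. -/
theorem mem_stabilizableSubspace_of_exponential {μ : ℝ} (hμ : 0 < μ) {z : Fin n → ℝ}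
    {w : Fin m → ℝ} (h : A *ᵥ z + B *ᵥ w = -(μ • z)) : z ∈ stabilizableSubspace A B := by
  have hc : Continuous fun t : ℝ => Real.exp (-(μ * t)) := by fun_prop
  refine ⟨fun t => Real.exp (-(μ * t)) • w, fun t => Real.exp (-(μ * t)) • z,
    ⟨fun t _ => (hc.smul continuous_const).intervalIntegrable _ _,
      (hc.smul continuous_const).continuousOn, fun t _ => ?_⟩, by simp, ?_⟩
  · have hd : ∀ s : ℝ, HasDerivAt (fun t => Real.exp (-(μ * t)) • z)
        (A *ᵥ (Real.exp (-(μ * s)) • z) + B *ᵥ (Real.exp (-(μ * s)) • w)) s := by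
      intro s
      have h1 : HasDerivAt (fun t => Real.exp (-(μ * t))) (Real.exp (-(μ * s)) * (-(μ * 1))) s :=
        (((hasDerivAt_id s).const_mul μ).neg).exp
      have h2 := h1.smul_const z
      have h3 : (Real.exp (-(μ * s)) * (-(μ * 1))) • z =
          A *ᵥ (Real.exp (-(μ * s)) • z) + B *ᵥ (Real.exp (-(μ * s)) • w) := by
        rw [mulVec_smul, mulVec_smul, ← smul_add, h, mul_smul]
        simp
      rwa [h3] at h2
    rw [intervalIntegral.integral_eq_sub_of_hasDerivAt (fun s _ => hd s)]
    · abel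
    · refine Continuous.intervalIntegrable ?_ _ _
      simp only [mulVec_smul, ← smul_add]
      exact hc.smul continuous_const
  · have h1 : Tendsto (fun t : ℝ => Real.exp (-(μ * t))) atTop (𝓝 0) :=
      Real.tendsto_exp_neg_atTop_nhds_zero.comp (tendsto_id.const_mul_atTop hμ)
    simpa using h1.smul_const z

/-- A linear map that intertwines two systems carries decaying trajectories to decaying
trajectories. It is applied to the projections and inclusions of a block decomposition. -/
theorem stabilizableSubspace_le_comap {n' m' : ℕ} {A' : Matrix (Fin n') (Fin n') ℝ}
    {B' : Matrix (Fin n') (Fin m') ℝ} (L : (Fin n → ℝ) →ₗ[ℝ] (Fin n' → ℝ))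
    (K : (Fin m → ℝ) →ₗ[ℝ] (Fin m' → ℝ))
    (h : ∀ x u, L (A *ᵥ x + B *ᵥ u) = A' *ᵥ L x + B' *ᵥ K u) :
    stabilizableSubspace A B ≤ (stabilizableSubspace A' B').comap L := by
  rintro _ ⟨u, x, hx, rfl, h0⟩
  let L' := LinearMap.toContinuousLinearMap L
  let K' := LinearMap.toContinuousLinearMap K
  refine ⟨fun t => K' (u t), fun t => L' (x t), ⟨fun t ht => ?_, ?_, fun t ht => ?_⟩, rfl, ?_⟩
  · rw [intervalIntegrable_iff_integrableOn_Ioc_of_le ht]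
    exact K'.integrable_comp (hx.input_integrable t ht).1
  · exact L'.continuous.comp_continuousOn hx.continuousOn
  · have h1 := L'.intervalIntegral_comp_comm (hx.integrable t ht)
    have h2 : ∀ s, L' (A *ᵥ x s + B *ᵥ u s) = A' *ᵥ L' (x s) + B' *ᵥ K' (u s) :=
      fun s => h _ _
    simp only [h2] at h1
    rw [h1, ← map_add, ← hx.eq_integral t ht]
  · have := (L'.continuous.tendsto 0).comp h0
    rwa [map_zero] at this

/-- A functional vanishing on the range of `[A, B]` is constant along a trajectory; if the
trajectory tends to `0`, the functional vanishes at `x 0`. -/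
theorem stabilizableSubspace_le_range :
    stabilizableSubspace A B ≤ LinearMap.range (fromCols A B).mulVecLin := by
  rintro _ ⟨u, x, hx, rfl, h0⟩
  by_contra hn
  obtain ⟨f, hf, hfW⟩ := Submodule.exists_le_ker_of_notMem hn
  let f' := LinearMap.toContinuousLinearMap f
  have hzero : ∀ s, f' (A *ᵥ x s + B *ᵥ u s) = 0 := fun s =>
    hfW ⟨Sum.elim (x s) (u s), by simp [fromCols_mulVec]⟩
  have hconst : ∀ t, 0 ≤ t → f' (x t) = f' (x 0) := by
    intro t ht
    have h1 := f'.intervalIntegral_comp_comm (hx.integrable t ht)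
    simp only [hzero, intervalIntegral.integral_zero] at h1
    conv_lhs => rw [hx.eq_integral t ht]
    rw [map_add, ← h1, add_zero]
  have h1 : Tendsto (fun t => f' (x t)) atTop (𝓝 0) := by
    have := (f'.continuous.tendsto 0).comp h0
    rwa [map_zero] at this
  have h2 : Tendsto (fun t => f' (x t)) atTop (𝓝 (f' (x 0))) :=
    tendsto_const_nhds.congr' (by
      filter_upwards [eventually_ge_atTop 0] with t ht using (hconst t ht).symm)
  exact hf (tendsto_nhds_unique h2 h1)

theorem finrank_stabilizableSubspace_le_rank :
    Module.finrank ℝ (stabilizableSubspace A B) ≤ (fromCols A B).rank :=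
  Submodule.finrank_mono stabilizableSubspace_le_range

/-- Along `x' = Ax` with `A` symmetric, `Q = xᵀAx` has derivative `2|Ax|²`. If `Q` starts at `0` and
tends to `0`, monotonicity forces `Q = 0`, hence `Ax = 0`, so `x` is constant and its limit `0` is
its initial value. -/
theorem eq_zero_of_mem_stabilizableSubspace (hA : A.IsSymm) {x₀ : Fin n → ℝ}
    (h : x₀ ∈ stabilizableSubspace A (0 : Matrix (Fin n) (Fin m) ℝ))
    (hQ : x₀ ⬝ᵥ A *ᵥ x₀ = 0) : x₀ = 0 := by
  obtain ⟨u, x, hx, rfl, h0⟩ := h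
  let L := LinearMap.toContinuousLinearMap A.mulVecLin
  have hL : ∀ z, L z = A *ᵥ z := fun _ => rfl
  -- Freezing the state at `x 0` for negative times makes the integrand continuous on `ℝ`, so the
  -- primitive `g`, which equals `x` on `[0, ∞)`, has a two-sided derivative even at `0`.
  set y : ℝ → Fin n → ℝ := fun t => x (max 0 t) with hy
  have hyc : Continuous y :=
    hx.continuousOn.comp_continuous (by fun_prop) (fun t => le_max_left 0 t)
  set g : ℝ → Fin n → ℝ := fun t => x 0 + ∫ s in (0 : ℝ)..t, L (y s) with hg
  have hgx : ∀ t, 0 ≤ t → g t = x t := by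
    intro t ht
    have h1 : ∫ s in (0 : ℝ)..t, L (y s) =
        ∫ s in (0 : ℝ)..t, (A *ᵥ x s + (0 : Matrix (Fin n) (Fin m) ℝ) *ᵥ u s) := by
      refine intervalIntegral.integral_congr fun s hs => ?_
      rw [Set.uIcc_of_le ht] at hs
      simp [hy, max_eq_right hs.1, hL]
    rw [hx.eq_integral t ht, hg, ← h1]
  have hd : ∀ t, HasDerivAt g (L (y t)) t := fun t =>
    ((L.continuous.comp hyc).integral_hasStrictDerivAt 0 t).hasDerivAt.const_add _
  have hyg : ∀ t, 0 ≤ t → y t = g t := by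
    intro t ht
    rw [hgx t ht, hy]
    simp [max_eq_right ht]
  have hdot : ∀ {a b : ℝ → Fin n → ℝ} {a' b' : Fin n → ℝ} {t : ℝ}, HasDerivAt a a' t →
      HasDerivAt b b' t →
      HasDerivAt (fun s => a s ⬝ᵥ b s) (a' ⬝ᵥ b t + a t ⬝ᵥ b') t := by
    intro a b a' b' t ha hb
    simp only [dotProduct, ← Finset.sum_add_distrib]
    have h1 : ∀ i ∈ Finset.univ,
        HasDerivAt (fun s => a s i * b s i) (a' i * b t i + a t i * b' i) t :=
      fun i _ => (hasDerivAt_pi.1 ha i).mul (hasDerivAt_pi.1 hb i)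
    exact HasDerivAt.fun_sum h1
  set Q : ℝ → ℝ := fun t => g t ⬝ᵥ L (g t) with hQdef
  have hQd : ∀ t, 0 ≤ t → HasDerivAt Q (2 * (L (g t) ⬝ᵥ L (g t))) t := by
    intro t ht
    have h1 := hdot (hd t) (L.hasFDerivAt.comp_hasDerivAt t (hd t))
    have h2 : g t ⬝ᵥ L (L (g t)) = L (g t) ⬝ᵥ L (g t) := by
      rw [hL (L (g t)), dotProduct_mulVec, ← mulVec_transpose, hA.eq, ← hL]
    have h3 : L (y t) ⬝ᵥ (L ∘ g) t + g t ⬝ᵥ L (L (y t)) = 2 * (L (g t) ⬝ᵥ L (g t)) := by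
      rw [hyg t ht, h2, Function.comp_apply]
      ring
    rw [h3] at h1
    exact h1
  have hmono : MonotoneOn Q (Set.Ici 0) := by
    refine monotoneOn_of_deriv_nonneg (convex_Ici 0)
      (fun t ht => (hQd t ht).continuousAt.continuousWithinAt)
      (fun t ht => (hQd t (interior_subset ht)).differentiableAt.differentiableWithinAt)
      fun t ht => ?_
    rw [(hQd t (interior_subset ht)).deriv]
    have : 0 ≤ L (g t) ⬝ᵥ L (g t) := by
      simp only [dotProduct]
      exact Finset.sum_nonneg fun i _ => mul_self_nonneg _
    positivity
  have hg0 : Tendsto g atTop (𝓝 0) := h0.congr' (by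
    filter_upwards [eventually_ge_atTop 0] with t ht using (hgx t ht).symm)
  have hQ0 : Tendsto Q atTop (𝓝 0) := by
    have hc : Continuous fun z : Fin n → ℝ => z ⬝ᵥ L z := by
      simp only [dotProduct]
      fun_prop
    have := (hc.tendsto 0).comp hg0
    rwa [zero_dotProduct] at this
  have hQz : ∀ t, 0 ≤ t → Q t = 0 := by
    intro t ht
    refine le_antisymm ?_ ?_
    · refine ge_of_tendsto hQ0 ?_
      filter_upwards [eventually_ge_atTop t] with s hs using hmono ht (ht.trans hs) hs
    · have h1 := hmono Set.self_mem_Ici ht ht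
      have h2 : Q 0 = 0 := by
        simp only [hQdef, hgx 0 le_rfl, hL, hQ]
      rwa [h2] at h1
  have hAz : ∀ t, 0 < t → L (g t) = 0 := by
    intro t ht
    have h1 : HasDerivAt Q 0 t := by
      refine (hasDerivAt_const t (0 : ℝ)).congr_of_eventuallyEq ?_
      filter_upwards [eventually_gt_nhds ht] with s hs using hQz s hs.le
    have h2 := h1.unique (hQd t ht.le)
    exact dotProduct_self_eq_zero.1 (by linarith)
  have hconst : ∀ t, 0 ≤ t → g t = x 0 := by
    intro t ht
    have : ∫ s in (0 : ℝ)..t, L (y s) = 0 := by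
      rw [intervalIntegral.integral_of_le ht]
      refine setIntegral_eq_zero_of_forall_eq_zero fun s hs => ?_
      rw [hyg s hs.1.le, hAz s hs.1]
    simp only [hg, this, add_zero]
  exact tendsto_nhds_unique (tendsto_const_nhds.congr' (by
    filter_upwards [eventually_ge_atTop 0] with t ht using (hconst t ht).symm)) hg0

/-- Vectors supported in `S` are isotropic for `A`, so a stabilizable vector vanishing off `S` is
`0`; restriction to the coordinates outside `S` is injective on the stabilizable subspace. -/
theorem finrank_stabilizableSubspace_le_of_isotropic (hA : A.IsSymm) (S : Finset (Fin n))
    (hS : ∀ i ∈ S, ∀ j ∈ S, A i j = 0) :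
    Module.finrank ℝ (stabilizableSubspace A (0 : Matrix (Fin n) (Fin m) ℝ)) + S.card ≤ n := by
  let f : stabilizableSubspace A (0 : Matrix (Fin n) (Fin m) ℝ) →ₗ[ℝ] ({i // i ∈ Sᶜ} → ℝ) :=
    (LinearMap.funLeft ℝ ℝ Subtype.val).comp (Submodule.subtype _)
  have hf : Function.Injective f := by
    rw [← LinearMap.ker_eq_bot, LinearMap.ker_eq_bot']
    rintro ⟨x, hx⟩ h
    have hz : ∀ i, i ∉ S → x i = 0 := fun i hi => congrFun h ⟨i, by simpa using hi⟩
    refine Subtype.ext (eq_zero_of_mem_stabilizableSubspace hA hx ?_)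
    simp only [dotProduct, mulVec]
    refine Finset.sum_eq_zero fun i _ => ?_
    by_cases hi : i ∈ S
    · rw [Finset.sum_eq_zero, mul_zero]
      intro j _
      by_cases hj : j ∈ S
      · rw [hS i hi j hj, zero_mul]
      · rw [hz j hj, mul_zero]
    · rw [hz i hi, zero_mul]
  have h1 := LinearMap.finrank_le_finrank_of_injective hf
  rw [Module.finrank_fintype_fun_eq_card, Fintype.card_coe, Finset.card_compl,
    Fintype.card_fin] at h1
  have := S.card_le_univ
  rw [Fintype.card_fin] at this
  omega

end Stabilizable

/-! ### Lower bounds: controllable vectors and negative definite subspaces -/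

section Lower
variable {n m : ℕ} {A : Matrix (Fin n) (Fin n) ℝ} {B : Matrix (Fin n) (Fin m) ℝ}

/-- Instead of steering to zero in finite time, use the resolvent vectors `z ε = (1 + εA)⁻¹ B w`:
for small `ε > 0` each decays at rate `ε⁻¹` under a suitable input, and they converge to `B w`.
Subspaces of `ℝⁿ` are closed, so limits remain stabilizable. -/
theorem pow_mulVec_mem_stabilizableSubspace (A : Matrix (Fin n) (Fin n) ℝ)
    (B : Matrix (Fin n) (Fin m) ℝ) (w : Fin m → ℝ) (k : ℕ) :
    (A ^ k * B) *ᵥ w ∈ stabilizableSubspace A B := by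
  set E := stabilizableSubspace A B
  have hclosed : IsClosed (E : Set (Fin n → ℝ)) := E.closed_of_finiteDimensional
  let z : ℝ → Fin n → ℝ := fun ε => (1 + ε • A)⁻¹ *ᵥ (B *ᵥ w)
  have hdet : ContinuousAt (fun ε : ℝ => (1 + ε • A).det) 0 := by fun_prop
  have hne : ∀ᶠ ε in 𝓝[>] (0 : ℝ), (1 + ε • A).det ≠ 0 :=
    (hdet.eventually_ne (by simp)).filter_mono nhdsWithin_le_nhds
  have hz : ∀ ε, (1 + ε • A).det ≠ 0 → z ε + ε • A *ᵥ z ε = B *ᵥ w := by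
    intro ε h
    have : (1 + ε • A) *ᵥ z ε = B *ᵥ w := by
      rw [mulVec_mulVec, mul_nonsing_inv _ (Ne.isUnit h), one_mulVec]
    rwa [add_mulVec, one_mulVec, smul_mulVec] at this
  have hlim : Tendsto z (𝓝[>] (0 : ℝ)) (𝓝 (B *ᵥ w)) := by
    have h1 : ContinuousAt (fun ε : ℝ => ((1 + ε • A).det)⁻¹ • (1 + ε • A).adjugate) 0 :=
      (hdet.inv₀ (by simp)).smul (by fun_prop)
    have h2 : ContinuousAt z 0 := by
      have : z = fun ε : ℝ => (((1 + ε • A).det)⁻¹ • (1 + ε • A).adjugate) *ᵥ (B *ᵥ w) := by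
        funext ε
        simp only [z, Matrix.inv_def, Ring.inverse_eq_inv']
      rw [this]
      exact (Continuous.matrix_mulVec continuous_id continuous_const).continuousAt.comp
        (f := fun ε : ℝ => ((1 + ε • A).det)⁻¹ • (1 + ε • A).adjugate) h1
    have h3 : z 0 = B *ᵥ w := by simp [z]
    rw [← h3]
    exact h2.tendsto.mono_left nhdsWithin_le_nhds
  have hmul : ∀ k, Tendsto (fun ε => A ^ k *ᵥ z ε) (𝓝[>] (0 : ℝ)) (𝓝 (A ^ k *ᵥ (B *ᵥ w))) :=
    fun k => ((Continuous.matrix_mulVec (continuous_const (y := A ^ k))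
      continuous_id).tendsto _).comp hlim
  have hmem : ∀ k, ∀ᶠ ε in 𝓝[>] (0 : ℝ), A ^ k *ᵥ z ε ∈ E := by
    intro k
    induction k with
    | zero =>
      filter_upwards [hne, self_mem_nhdsWithin] with ε h hε
      simp only [pow_zero, one_mulVec]
      refine mem_stabilizableSubspace_of_exponential (μ := ε⁻¹) (w := -(ε⁻¹ • w))
        (inv_pos.2 hε) ?_
      rw [mulVec_neg, mulVec_smul, ← hz ε h, smul_add, smul_smul,
        inv_mul_cancel₀ (ne_of_gt hε), one_smul]
      abel
    | succ k ih =>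
      have hk : A ^ k *ᵥ (B *ᵥ w) ∈ E := hclosed.mem_of_tendsto (hmul k) ih
      filter_upwards [hne, self_mem_nhdsWithin, ih] with ε h hε hi
      -- The resolvent equation expresses `A ^ (k + 1) z ε` by vectors already known to be
      -- stabilizable at level `k`.
      have h1 : A ^ (k + 1) *ᵥ z ε = ε⁻¹ • (A ^ k *ᵥ (B *ᵥ w) - A ^ k *ᵥ z ε) := by
        rw [← hz ε h, mulVec_add, add_sub_cancel_left, mulVec_smul, smul_smul,
          inv_mul_cancel₀ (ne_of_gt hε), one_smul, pow_succ, ← mulVec_mulVec]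
      rw [h1]
      exact E.smul_mem _ (E.sub_mem hk hi)
  rw [← mulVec_mulVec]
  exact hclosed.mem_of_tendsto (hmul k) (hmem k)

theorem rank_ctrbMatrix_le_finrank_stabilizableSubspace :
    (ctrbMatrix A B).rank ≤ Module.finrank ℝ (stabilizableSubspace A B) := by
  refine Submodule.finrank_mono ?_
  rw [range_mulVecLin, Submodule.span_le]
  rintro _ ⟨⟨k, j⟩, rfl⟩
  have : (ctrbMatrix A B).col (k, j) = (A ^ (k : ℕ) * B) *ᵥ Pi.single j 1 := by
    ext i
    simp [ctrbMatrix]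
  rw [this]
  exact pow_mulVec_mem_stabilizableSubspace A B _ _

theorem exists_eigenvector_expansion {ι : Type*} [Fintype ι] [DecidableEq ι] {A : Matrix ι ι ℝ}
    (hA : A.IsSymm) :
    ∃ (μ : ι → ℝ) (b : ι → ι → ℝ), (∀ i, A *ᵥ b i = μ i • b i) ∧
      (∀ x, x = ∑ i, (b i ⬝ᵥ x) • b i) := by
  have hH : A.IsHermitian := by
    rw [IsHermitian, conjTranspose_eq_transpose_of_trivial, hA.eq]
  refine ⟨hH.eigenvalues, fun i => ⇑(hH.eigenvectorBasis i), fun i => hH.mulVec_eigenvectorBasis i,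
    fun x => ?_⟩
  have h := hH.eigenvectorBasis.sum_repr' (WithLp.toLp 2 x)
  have h2 := congrArg WithLp.ofLp h
  simp only [WithLp.ofLp_sum, WithLp.ofLp_smul] at h2
  conv_lhs => rw [← h2]
  refine Finset.sum_congr rfl fun i _ => ?_
  congr 1
  simp [EuclideanSpace.inner_eq_star_dotProduct, dotProduct_comm]

/-- Negative eigenvectors decay with zero input. A vector without components along them has `xᵀAx ≥
0`, so the spectral projection to their span is injective on the image of `Φ`. -/
theorem finrank_le_finrank_stabilizableSubspace_of_negDef (hA : A.IsSymm)
    {α : Type*} [Fintype α] (Φ : (α → ℝ) →ₗ[ℝ] (Fin n → ℝ))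
    (hΦ : ∀ c, c ≠ 0 → Φ c ⬝ᵥ A *ᵥ Φ c < 0) :
    Fintype.card α ≤ Module.finrank ℝ (stabilizableSubspace A B) := by
  obtain ⟨μ, b, hb, hx⟩ := exists_eigenvector_expansion hA
  let P : (Fin n → ℝ) →ₗ[ℝ] (Fin n → ℝ) :=
    ∑ i with μ i < 0, (dotProductBilin ℝ ℝ (b i)).smulRight (b i)
  have hP : ∀ x, P x = ∑ i with μ i < 0, (b i ⬝ᵥ x) • b i := by
    intro x
    simp [P, LinearMap.sum_apply]
  have hmem : ∀ x, P x ∈ stabilizableSubspace A B := by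
    intro x
    rw [hP]
    refine Submodule.sum_mem _ fun i hi => Submodule.smul_mem _ _ ?_
    refine mem_stabilizableSubspace_of_exponential (μ := -μ i) (w := 0)
      (neg_pos.2 (Finset.mem_filter.1 hi).2) ?_
    rw [mulVec_zero, add_zero, hb, neg_smul, neg_neg]
  have hinj : Function.Injective ((P.codRestrict _ hmem).comp Φ) := by
    rw [← LinearMap.ker_eq_bot, LinearMap.ker_eq_bot']
    intro c hc
    have hc' : P (Φ c) = 0 := congrArg Subtype.val hc
    by_contra hne
    refine absurd (hΦ c hne) (not_lt.2 ?_)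
    have h1 : Φ c ⬝ᵥ A *ᵥ Φ c = ∑ i, μ i * (b i ⬝ᵥ Φ c) ^ 2 := by
      have : A *ᵥ Φ c = ∑ i, (b i ⬝ᵥ Φ c) • (μ i • b i) := by
        conv_lhs => rw [hx (Φ c)]
        rw [mulVec_sum]
        refine Finset.sum_congr rfl fun i _ => ?_
        rw [mulVec_smul, hb]
      rw [this, dotProduct_sum]
      refine Finset.sum_congr rfl fun i _ => ?_
      rw [dotProduct_smul, dotProduct_smul, dotProduct_comm (Φ c), smul_eq_mul, smul_eq_mul]
      ring
    have h2 : ∑ i with μ i < 0, μ i * (b i ⬝ᵥ Φ c) ^ 2 = 0 := by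
      have h3 : (A *ᵥ P (Φ c)) ⬝ᵥ Φ c = 0 := by rw [hc']; simp
      rw [hP, mulVec_sum, sum_dotProduct] at h3
      refine Eq.trans (Finset.sum_congr rfl fun i _ => ?_) h3
      rw [mulVec_smul, hb, smul_dotProduct, smul_dotProduct, smul_eq_mul, smul_eq_mul]
      ring
    rw [h1, ← Finset.sum_filter_add_sum_filter_not _ (fun i => μ i < 0), h2, zero_add]
    refine Finset.sum_nonneg fun i hi => mul_nonneg ?_ (sq_nonneg _)
    exact not_lt.1 (Finset.mem_filter.1 hi).2
  have := LinearMap.finrank_le_finrank_of_injective hinj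
  rwa [Module.finrank_fintype_fun_eq_card] at this

end Lower

/-! ### The coordinate support of the left kernel -/

section LeftKernel
variable {ι κ : Type*} [Fintype ι]

open Classical in
/-- The coordinates that do not vanish identically on the left kernel of a matrix. -/
noncomputable def leftKerSupport (M : Matrix ι κ ℝ) : Finset ι :=
  Finset.univ.filter fun i => ∃ v : ι → ℝ, v ᵥ* M = 0 ∧ v i ≠ 0

theorem mem_leftKerSupport {M : Matrix ι κ ℝ} {i : ι} :
    i ∈ leftKerSupport M ↔ ∃ v : ι → ℝ, v ᵥ* M = 0 ∧ v i ≠ 0 := by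
  simp [leftKerSupport]

theorem eq_zero_of_notMem_leftKerSupport {M : Matrix ι κ ℝ} {i : ι} (hi : i ∉ leftKerSupport M)
    {v : ι → ℝ} (hv : v ᵥ* M = 0) : v i = 0 := by
  by_contra h
  exact hi (mem_leftKerSupport.2 ⟨v, hv, h⟩)

theorem exists_both_ne_zero_of_mem_leftKerSupport {M : Matrix ι κ ℝ} {i j : ι}
    (hi : i ∈ leftKerSupport M) (hj : j ∈ leftKerSupport M) :
    ∃ v : ι → ℝ, v ᵥ* M = 0 ∧ v i ≠ 0 ∧ v j ≠ 0 := by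
  obtain ⟨u, hu, hui⟩ := mem_leftKerSupport.1 hi
  obtain ⟨w, hw, hwj⟩ := mem_leftKerSupport.1 hj
  by_cases huj : u j = 0
  · by_cases hwi : w i = 0
    · exact ⟨u + w, by rw [add_vecMul, hu, hw, add_zero], by simpa [hwi], by simpa [huj]⟩
    · exact ⟨w, hw, hwi, hwj⟩
  · exact ⟨u, hu, hui, huj⟩

/-- The matrix with one more column, a coordinate vector. -/
def appendSingle [DecidableEq ι] (M : Matrix ι κ ℝ) (i : ι) : Matrix ι (κ ⊕ Unit) ℝ :=
  fromCols M (replicateCol Unit (Pi.single i 1))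

variable [Fintype κ]

/-- The left kernel annihilates the column space, so some kernel vector is nonzero at `i` exactly
when `e_i` is not a combination of columns. Membership becomes a rank inequality, to which
semicontinuity of rank applies. -/
theorem mem_leftKerSupport_iff_rank_lt [DecidableEq ι] {M : Matrix ι κ ℝ} {i : ι} :
    i ∈ leftKerSupport M ↔ M.rank < (appendSingle M i).rank := by
  classical
  have hle : LinearMap.range M.mulVecLin ≤ LinearMap.range (appendSingle M i).mulVecLin := by
    rintro _ ⟨x, rfl⟩
    exact ⟨Sum.elim x 0, by simp [appendSingle, fromCols_mulVec]⟩
  constructor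
  · intro h
    obtain ⟨v, hv, hvi⟩ := mem_leftKerSupport.1 h
    refine Submodule.finrank_lt_finrank_of_lt (lt_of_le_of_ne hle fun heq => ?_)
    have h1 : Pi.single i 1 ∈ LinearMap.range (appendSingle M i).mulVecLin :=
      ⟨Sum.elim 0 1, by
        simp only [appendSingle, mulVecLin_apply, fromCols_mulVec_sumElim, mulVec_zero, zero_add]
        ext j
        simp [mulVec, dotProduct]⟩
    rw [← heq] at h1
    obtain ⟨x, hx⟩ := h1
    rw [mulVecLin_apply] at hx
    have h2 : v ⬝ᵥ M *ᵥ x = v i := by rw [hx]; simp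
    rw [dotProduct_mulVec, hv, zero_dotProduct] at h2
    exact hvi h2.symm
  · intro h
    by_contra hn
    refine absurd h (not_lt.2 (Submodule.finrank_mono ?_))
    have h1 : Pi.single i 1 ∈ LinearMap.range M.mulVecLin := by
      by_contra hni
      obtain ⟨f, hf, hfW⟩ := Submodule.exists_le_ker_of_notMem hni
      refine hn (mem_leftKerSupport.2 ⟨fun j => f (Pi.single j 1), ?_, hf⟩)
      ext k
      have h2 : f (M *ᵥ Pi.single k 1) = 0 := hfW ⟨_, rfl⟩
      rw [mulVec_single_one, ← (Pi.basisFun ℝ ι).sum_repr (M.col k), map_sum] at h2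
      simpa [vecMul, dotProduct, mul_comm] using h2
    rintro _ ⟨x, rfl⟩
    rw [mulVecLin_apply, appendSingle, fromCols_mulVec]
    refine Submodule.add_mem _ ⟨_, rfl⟩ ?_
    have h2 : replicateCol Unit (Pi.single i (1 : ℝ)) *ᵥ (x ∘ Sum.inr) =
        x (Sum.inr ()) • Pi.single i 1 := by
      ext j
      simp [mulVec, dotProduct, mul_comm]
    rw [h2]
    exact Submodule.smul_mem _ _ h1

theorem eventually_rank_le_rank_add_smul (M D : Matrix ι κ ℝ) :
    ∀ᶠ t in 𝓝 (0 : ℝ), M.rank ≤ (M + t • D).rank := by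
  obtain ⟨r, c, h⟩ := exists_submatrix_det_ne_zero M
  have hc : ContinuousAt (fun t : ℝ => ((M + t • D).submatrix r c).det) 0 := by
    refine Continuous.continuousAt (Continuous.matrix_det ?_)
    exact Continuous.matrix_submatrix (by fun_prop) _ _
  filter_upwards [hc.eventually_ne (by simpa using h)] with t ht
  simpa using le_rank_of_submatrix_det_ne_zero _ r c ht

/-- Under a small perturbation the rank with the extra column cannot drop, while the rank of `M`
cannot rise by assumption; the strict inequality between them persists. -/
theorem eventually_leftKerSupport_subset (M D : Matrix ι κ ℝ)
    (hmax : ∀ᶠ t in 𝓝 (0 : ℝ), (M + t • D).rank ≤ M.rank) :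
    ∀ᶠ t in 𝓝 (0 : ℝ), leftKerSupport M ⊆ leftKerSupport (M + t • D) := by
  classical
  have h1 : ∀ i ∈ leftKerSupport M, ∀ᶠ t in 𝓝 (0 : ℝ), i ∈ leftKerSupport (M + t • D) := by
    intro i hi
    rw [mem_leftKerSupport_iff_rank_lt] at hi
    filter_upwards [hmax, eventually_rank_le_rank_add_smul (appendSingle M i) (fromCols D 0)]
      with t h2 h3
    have h4 : appendSingle M i + t • fromCols D 0 = appendSingle (M + t • D) i := by
      ext a (b | b) <;> simp [appendSingle]
    rw [h4] at h3
    exact mem_leftKerSupport_iff_rank_lt.2 (by omega)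
  filter_upwards [(Finset.eventually_all _).2 h1] with t ht i hi using ht i hi

theorem finrank_ker_vecMulLinear_add_rank (M : Matrix ι κ ℝ) :
    Module.finrank ℝ (LinearMap.ker M.vecMulLinear) + M.rank = Fintype.card ι := by
  have h := LinearMap.finrank_range_add_finrank_ker M.vecMulLinear
  rw [Module.finrank_fintype_fun_eq_card] at h
  have h2 : M.vecMulLinear = Mᵀ.mulVecLin := by
    ext; simp
  have h3 : Module.finrank ℝ (LinearMap.range M.vecMulLinear) = M.rank := by
    rw [h2, ← rank_transpose M]
    rfl
  omega

/-- If the unit row vectors for the columns in `N` are combinations of rows in the support of the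
left kernel, then `N` is small. -/
theorem card_add_card_le_of_single_mem_rows [DecidableEq κ] (M : Matrix ι κ ℝ) (N : Finset κ)
    (hN : ∀ j ∈ N, ∃ v : ι → ℝ, (∀ i, i ∉ leftKerSupport M → v i = 0) ∧
      v ᵥ* M = Pi.single j 1) :
    N.card + Fintype.card ι ≤ (leftKerSupport M).card + M.rank := by
  classical
  set I := leftKerSupport M
  let MI := M.submatrix (Subtype.val : {i // i ∈ I} → ι) id
  have hres : ∀ v : ι → ℝ, (∀ i, i ∉ I → v i = 0) →
      (fun i : {i // i ∈ I} => v i) ᵥ* MI = v ᵥ* M := by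
    intro v hv
    ext j
    simp only [vecMul, dotProduct, MI, submatrix_apply, id]
    rw [Finset.sum_coe_sort I (fun i => v i * M i j)]
    exact Finset.sum_subset (Finset.subset_univ _) fun i _ hi => by rw [hv i hi, zero_mul]
  have h1 := LinearMap.finrank_range_add_finrank_ker MI.vecMulLinear
  rw [Module.finrank_fintype_fun_eq_card, Fintype.card_coe] at h1
  -- Kernel vectors vanish off `I`, so they remain kernel vectors of the row submatrix `MI`. This
  -- bounds the rank of `MI` by `|I|` minus the dimension of the left kernel of `M`.
  have h2 : Module.finrank ℝ (LinearMap.ker M.vecMulLinear) ≤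
      Module.finrank ℝ (LinearMap.ker MI.vecMulLinear) := by
    let f : LinearMap.ker M.vecMulLinear →ₗ[ℝ] LinearMap.ker MI.vecMulLinear :=
      ((LinearMap.funLeft ℝ ℝ (Subtype.val : {i // i ∈ I} → ι)).comp
        (Submodule.subtype _)).codRestrict _ (by
          rintro ⟨v, hv⟩
          exact (hres v fun i hi => eq_zero_of_notMem_leftKerSupport hi hv).trans hv)
    refine LinearMap.finrank_le_finrank_of_injective (f := f) ?_
    rw [← LinearMap.ker_eq_bot, LinearMap.ker_eq_bot']
    rintro ⟨v, hv⟩ h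
    ext i
    by_cases hi : i ∈ I
    · exact congrFun (congrArg Subtype.val h) ⟨i, hi⟩
    · exact eq_zero_of_notMem_leftKerSupport hi hv
  have h3 : N.card ≤ Module.finrank ℝ (LinearMap.range MI.vecMulLinear) := by
    have hmem : ∀ j : {j // j ∈ N}, (Pi.single j.1 1 : κ → ℝ) ∈
        LinearMap.range MI.vecMulLinear := by
      rintro ⟨j, hj⟩
      obtain ⟨v, hv, hvj⟩ := hN j hj
      exact ⟨_, (hres v hv).trans hvj⟩
    have hli : LinearIndependent ℝ (fun j : {j // j ∈ N} =>
        (⟨_, hmem j⟩ : LinearMap.range MI.vecMulLinear)) := by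
      refine LinearIndependent.of_comp (Submodule.subtype _) ?_
      have := (Pi.basisFun ℝ κ).linearIndependent.comp (Subtype.val : {j // j ∈ N} → κ)
        Subtype.val_injective
      convert this using 1
      ext j
      simp
    simpa using hli.fintype_card_le_finrank
  have h4 := finrank_ker_vecMulLinear_add_rank M
  omega

end LeftKernel

/-! ### Symmetric realizations attain the term rank -/

section GenericRank
variable {ι κ : Type*} [Fintype ι] [Fintype κ] {A : Matrix ι ι Entry} {B : Matrix ι κ Entry}

/-- A conforming pair whose rank is maximal, and the support of whose left kernel is maximal among
those. -/
theorem exists_maximal_conforming (A : Matrix ι ι Entry) (B : Matrix ι κ Entry) :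
    ∃ (X : Matrix ι ι ℝ) (Y : Matrix ι κ ℝ), X.IsSymm ∧ Conforms A X ∧ Conforms B Y ∧
      ∀ (X' : Matrix ι ι ℝ) (Y' : Matrix ι κ ℝ), X'.IsSymm → Conforms A X' → Conforms B Y' →
        (fromCols X' Y').rank ≤ (fromCols X Y).rank ∧
        ((fromCols X' Y').rank = (fromCols X Y).rank →
          (leftKerSupport (fromCols X' Y')).card ≤ (leftKerSupport (fromCols X Y)).card) := by
  classical
  let N := Fintype.card ι
  -- The weight `N + 1` exceeds every support size, so maximizing `f` maximizes lexicographically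
  -- the rank and then the support.
  let f : Matrix ι (ι ⊕ κ) ℝ → ℕ := fun M => M.rank * (N + 1) + (leftKerSupport M).card
  let s : Set ℕ := {k | ∃ (X : Matrix ι ι ℝ) (Y : Matrix ι κ ℝ), X.IsSymm ∧ Conforms A X ∧
    Conforms B Y ∧ k = f (fromCols X Y)}
  have hcard : ∀ M : Matrix ι (ι ⊕ κ) ℝ, (leftKerSupport M).card ≤ N :=
    fun M => Finset.card_le_univ _
  have hb : BddAbove s := by
    refine ⟨N * (N + 1) + N, ?_⟩
    rintro k ⟨X, Y, -, -, -, rfl⟩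
    exact add_le_add (Nat.mul_le_mul_right _ (rank_le_card_height _)) (hcard _)
  obtain ⟨X, Y, h1, h2, h3, h4⟩ : sSup s ∈ s :=
    Nat.sSup_mem ⟨_, 0, 0, transpose_zero, fun _ _ _ => rfl, fun _ _ _ => rfl, rfl⟩ hb
  refine ⟨X, Y, h1, h2, h3, fun X' Y' h1' h2' h3' => ?_⟩
  have h5 : f (fromCols X' Y') ≤ f (fromCols X Y) := by
    rw [← h4]
    exact le_csSup hb ⟨X', Y', h1', h2', h3', rfl⟩
  simp only [f] at h5
  have h6 := hcard (fromCols X' Y')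
  have h7 := hcard (fromCols X Y)
  constructor
  · by_contra hlt
    have : (fromCols X Y).rank + 1 ≤ (fromCols X' Y').rank := by omega
    nlinarith
  · intro h
    rw [h] at h5
    omega

/-- The maximal rank of a symmetrically structured pair is its term rank. -/
theorem exists_conforming_tRank_le_rank [DecidableEq ι] [DecidableEq κ] (hA : A.IsSymm) :
    ∃ (X : Matrix ι ι ℝ) (Y : Matrix ι κ ℝ), X.IsSymm ∧ Conforms A X ∧ Conforms B Y ∧
      tRank (fromCols A B) ≤ (fromCols X Y).rank := by
  obtain ⟨X, Y, hXs, hX, hY, hmax⟩ := exists_maximal_conforming A B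
  refine ⟨X, Y, hXs, hX, hY, ?_⟩
  set M := fromCols X Y with hM
  set I := leftKerSupport M with hI
  -- By the double maximality, small admissible perturbations leave both rank and support unchanged.
  have hstab : ∀ (S : Matrix ι ι ℝ) (T : Matrix ι κ ℝ), S.IsSymm → Conforms A S → Conforms B T →
      ∀ᶠ t in 𝓝 (0 : ℝ), leftKerSupport (M + t • fromCols S T) = I := by
    intro S T hSs hS hT
    have h0 : ∀ t : ℝ, M + t • fromCols S T = fromCols (X + t • S) (Y + t • T) := by
      intro t
      ext a (b | b) <;> simp [hM]
    have h1 : ∀ t : ℝ, (X + t • S).IsSymm := fun t => hXs.add (hSs.smul t)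
    have h2 : ∀ t : ℝ, Conforms A (X + t • S) := fun t i j h => by
      simp [hX i j h, hS i j h]
    have h3 : ∀ t : ℝ, Conforms B (Y + t • T) := fun t i j h => by
      simp [hY i j h, hT i j h]
    have h4 : ∀ t : ℝ, (M + t • fromCols S T).rank ≤ M.rank := fun t => by
      rw [h0]; exact (hmax _ _ (h1 t) (h2 t) (h3 t)).1
    filter_upwards [eventually_leftKerSupport_subset M (fromCols S T) (Eventually.of_forall h4),
      eventually_rank_le_rank_add_smul M (fromCols S T)] with t h5 h6
    refine (Finset.eq_of_subset_of_card_le h5 ?_).symm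
    have h7 := (hmax _ _ (h1 t) (h2 t) (h3 t)).2
    rw [← h0] at h7
    exact h7 (le_antisymm (h4 t) h6)
  have hpick : ∀ {P : ℝ → Prop}, (∀ᶠ t in 𝓝 (0 : ℝ), P t) →
      ∃ s t, s ≠ 0 ∧ t ≠ 0 ∧ s ≠ t ∧ P s ∧ P t := by
    intro P h
    obtain ⟨ε, hε, hP⟩ := Metric.eventually_nhds_iff.1 h
    refine ⟨ε / 2, ε / 3, by positivity, by positivity, ?_, hP ?_, hP ?_⟩
    · intro h; linarith
    · rw [Real.dist_0_eq_abs, abs_of_pos (by positivity)]; linarith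
    · rw [Real.dist_0_eq_abs, abs_of_pos (by positivity)]; linarith
  -- Perturb the star at `(i, j)` and take a kernel vector `v` of the perturbed matrix with `v i ≠
  -- 0`. If the perturbation contributes only `v i • e_j`, the kernel equation exhibits `e_j` as a
  -- combination of rows in `I`.
  have hrow : ∀ i ∈ I, ∀ j, fromCols A B i j = Entry.star →
      ∃ v : ι → ℝ, (∀ i, i ∉ I → v i = 0) ∧ v ᵥ* M = Pi.single j 1 := by
    have hfin : ∀ (i : ι) (j : ι ⊕ κ) (t : ℝ) (D : Matrix ι (ι ⊕ κ) ℝ) (v : ι → ℝ), t ≠ 0 →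
        leftKerSupport (M + t • D) = I → v ᵥ* (M + t • D) = 0 → v i ≠ 0 →
        v ᵥ* D = v i • Pi.single j 1 →
        ∃ v : ι → ℝ, (∀ i, i ∉ I → v i = 0) ∧ v ᵥ* M = Pi.single j 1 := by
      intro i j t D v ht hIt hv hvi hvD
      refine ⟨(-(t * v i))⁻¹ • v, fun k hk => ?_, ?_⟩
      · rw [← hIt] at hk
        simp [eq_zero_of_notMem_leftKerSupport hk hv]
      · rw [vecMul_add, vecMul_smul, hvD, smul_smul] at hv
        rw [smul_vecMul, eq_neg_of_add_eq_zero_left hv, ← neg_smul, smul_smul,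
          inv_mul_cancel₀ (neg_ne_zero.2 (mul_ne_zero ht hvi)), one_smul]
    rintro i hi (j | j) hj
    · have hAij : A i j = Entry.star := hj
      have hAji : A j i = Entry.star := by rw [← hAij, hA.apply]
      let S : Matrix ι ι ℝ := single i j 1 + single j i 1
      have hvS : ∀ v : ι → ℝ, v ᵥ* S = v i • Pi.single j 1 + v j • Pi.single i 1 := by
        intro v
        simp only [S, vecMul_add]
        ext k
        simp [vecMul, dotProduct, single_apply, Pi.single_apply, eq_comm, ite_and]
      have hSs : S.IsSymm := by
        simp [S, IsSymm, transpose_add, transpose_single, add_comm]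
      have hS : Conforms A S := by
        intro a b hab
        have h1 : ¬ (i = a ∧ j = b) := by rintro ⟨rfl, rfl⟩; exact hab hAij
        have h2 : ¬ (j = a ∧ i = b) := by rintro ⟨rfl, rfl⟩; exact hab hAji
        simp [S, h1, h2]
      obtain ⟨s, t, hs0, ht0, hst, hs, ht⟩ :=
        hpick (hstab S 0 hSs hS (fun _ _ _ => rfl))
      have hvD : ∀ v : ι → ℝ, v ᵥ* fromCols S (0 : Matrix ι κ ℝ) =
          Sum.elim (v i • Pi.single j 1 + v j • Pi.single i 1) (0 : κ → ℝ) := by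
        intro v
        rw [vecMul_fromCols, hvS, vecMul_zero]
      by_cases hjI : j ∈ I
      -- A star inside `I × I` is impossible. By symmetry, kernel vectors `v`, `w` at distinct
      -- perturbation sizes satisfy `v i * w j + v j * w i = 0`, so the ratios `v j / v i` and `w j
      -- / w i` are opposite. At the three sizes `0`, `s`, `t` they would be pairwise opposite,
      -- hence zero.
      · exfalso
        have key : ∀ (a b : ℝ) (v w : ι → ℝ), a ≠ b →
            v ᵥ* (M + a • fromCols S (0 : Matrix ι κ ℝ)) = 0 →
            w ᵥ* (M + b • fromCols S (0 : Matrix ι κ ℝ)) = 0 → v i * w j + v j * w i = 0 := by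
          intro a b v w hab hv hw
          have hl : ∀ (c : ℝ) (z : ι → ℝ), z ᵥ* (M + c • fromCols S (0 : Matrix ι κ ℝ)) = 0 →
              z ᵥ* X = -(c • (z ᵥ* S)) := by
            intro c z hz
            have h1 : M + c • fromCols S (0 : Matrix ι κ ℝ) = fromCols (X + c • S) Y := by
              ext x (y | y) <;> simp [hM]
            rw [h1, vecMul_fromCols] at hz
            have h2 : z ᵥ* (X + c • S) = 0 := by
              ext k
              exact congrFun hz (Sum.inl k)
            rw [vecMul_add, vecMul_smul] at h2
            exact eq_neg_of_add_eq_zero_left h2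
          have h1 : (v ᵥ* X) ⬝ᵥ w = (w ᵥ* X) ⬝ᵥ v := by
            rw [← dotProduct_mulVec, ← vecMul_transpose, hXs.eq, dotProduct_comm]
          have h2 : (v ᵥ* S) ⬝ᵥ w = (w ᵥ* S) ⬝ᵥ v := by
            rw [← dotProduct_mulVec, ← vecMul_transpose, hSs.eq, dotProduct_comm]
          rw [hl a v hv, hl b w hw, neg_dotProduct, neg_dotProduct, smul_dotProduct,
            smul_dotProduct, ← h2, smul_eq_mul, smul_eq_mul] at h1
          have h3 : (v ᵥ* S) ⬝ᵥ w = 0 := by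
            have : (a - b) * ((v ᵥ* S) ⬝ᵥ w) = 0 := by linarith
            exact (mul_eq_zero.1 this).resolve_left (sub_ne_zero.2 hab)
          rw [hvS, add_dotProduct, smul_dotProduct, smul_dotProduct] at h3
          simpa using h3
        obtain ⟨v, hv, hvi, hvj⟩ := exists_both_ne_zero_of_mem_leftKerSupport (M := M) hi hjI
        obtain ⟨w, hw, hwi, hwj⟩ :=
          exists_both_ne_zero_of_mem_leftKerSupport (hs.symm ▸ hi) (hs.symm ▸ hjI)
        obtain ⟨z, hz, hzi, hzj⟩ :=
          exists_both_ne_zero_of_mem_leftKerSupport (ht.symm ▸ hi) (ht.symm ▸ hjI)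
        have hv' : v ᵥ* (M + (0 : ℝ) • fromCols S (0 : Matrix ι κ ℝ)) = 0 := by
          rwa [zero_smul, add_zero]
        have e1 := key 0 s v w hs0.symm hv' hw
        have e2 := key 0 t v z ht0.symm hv' hz
        have e3 := key s t w z hst hw hz
        have : 2 * (w i * v j * z i) = 0 := by
          linear_combination (-(v i)) * e3 + w i * e2 + z i * e1
        exact (mul_ne_zero two_ne_zero (mul_ne_zero (mul_ne_zero hwi hvj) hzi)) this
      · obtain ⟨v, hv, hvi⟩ := mem_leftKerSupport.1 (ht.symm ▸ hi)
        have hvj : v j = 0 := eq_zero_of_notMem_leftKerSupport (ht.symm ▸ hjI) hv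
        refine hfin i (Sum.inl j) t _ v ht0 ht hv hvi ?_
        rw [hvD, hvj, zero_smul, add_zero]
        ext (k | k) <;> simp [Pi.single_apply]
    · have hBij : B i j = Entry.star := hj
      have hT : Conforms B (single i j (1 : ℝ)) := by
        intro a b hab
        have h1 : ¬ (i = a ∧ j = b) := by rintro ⟨rfl, rfl⟩; exact hab hBij
        simp [h1]
      obtain ⟨s, t, -, ht0, -, -, ht⟩ :=
        hpick (hstab 0 (single i j 1) transpose_zero (fun _ _ _ => rfl) hT)
      obtain ⟨v, hv, hvi⟩ := mem_leftKerSupport.1 (ht.symm ▸ hi)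
      refine hfin i (Sum.inr j) t _ v ht0 ht hv hvi ?_
      rw [vecMul_fromCols]
      ext (k | k) <;>
        simp [vecMul, dotProduct, single_apply, Pi.single_apply, eq_comm, ite_and]
  classical
  -- The columns in `N` and the rows outside `I` cover every star, so their number, at most the
  -- rank, bounds the term rank.
  let N : Finset (ι ⊕ κ) := Finset.univ.filter fun j => ∃ i ∈ I, fromCols A B i j = Entry.star
  have hcount := card_add_card_le_of_single_mem_rows M N (by
    intro j hj
    obtain ⟨i, hi, hij⟩ := (Finset.mem_filter.1 hj).2
    exact hrow i hi j hij)
  obtain ⟨r, c, hrc⟩ := (tRank_isGreatest (fromCols A B)).1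
  have h1 : (Finset.univ.filter fun l => r l ∈ I).card ≤ N.card := by
    refine Finset.card_le_card_of_injOn c (fun l hl => ?_) c.injective.injOn
    simp only [Finset.coe_filter, Finset.mem_univ, true_and, Set.mem_ofPred_eq] at hl
    simp only [N, Finset.coe_filter, Finset.mem_univ, true_and, Set.mem_ofPred_eq]
    exact ⟨_, hl, hrc l⟩
  have h2 : (Finset.univ.filter fun l => r l ∉ I).card ≤ Iᶜ.card := by
    refine Finset.card_le_card_of_injOn r (fun l hl => ?_) r.injective.injOn
    simpa using hl
  have h3 := Finset.card_filter_add_card_filter_not (s := Finset.univ) (fun l => r l ∈ I)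
  rw [Finset.card_univ, Fintype.card_fin] at h3
  rw [Finset.card_compl] at h2
  have h4 : I.card ≤ Fintype.card ι := Finset.card_le_univ _
  rw [← hI] at hcount
  omega

end GenericRank

/-! ### Algebraically independent reals and eigenvectors over subfields -/

section AlgebraicIndependence

/-- A transcendence basis of `ℝ` over `ℚ` is infinite, since otherwise `ℝ` would be countable. -/
theorem exists_algebraicIndependent_real (σ : Type*) [Finite σ] :
    ∃ x : σ → ℝ, AlgebraicIndependent ℚ x := by
  obtain ⟨ι, b, hb⟩ := exists_isTranscendenceBasis' ℚ ℝ
  have hinf : Infinite ι := by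
    by_contra hfin
    rw [not_infinite_iff_finite] at hfin
    have hle : Cardinal.mk ℝ ≤ Cardinal.aleph0 := by
      rcases isEmpty_or_nonempty ι with h | h
      · have : Algebra.IsAlgebraic ℚ ℝ := hb.isEmpty_iff_isAlgebraic.1 h
        simpa using Algebra.IsAlgebraic.cardinalMk_le_max ℚ ℝ
      · have h1 := hb.lift_cardinalMk_eq_max_lift
        have h2 : Cardinal.mk ι ≤ Cardinal.aleph0 := Cardinal.mk_le_aleph0
        simp only [Cardinal.lift_uzero, Cardinal.mkRat] at h1
        rw [h1]
        simp [h2]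
    rw [Cardinal.mk_real] at hle
    exact absurd hle (not_le.2 Cardinal.aleph0_lt_continuum)
  have : Countable σ := Finite.to_countable
  obtain ⟨f, hf⟩ := exists_injective_nat σ
  exact ⟨b ∘ (Infinite.natEmbedding ι ∘ f),
    hb.1.comp _ ((Infinite.natEmbedding ι).injective.comp hf)⟩

/-- Part of a family of algebraically independent reals lies in a relatively algebraically closed
field over which the rest of the family is algebraically independent. -/
theorem exists_subfield_algebraicIndependent {σ : Type*} {x : σ → ℝ}
    (hx : AlgebraicIndependent ℚ x) (s : Set σ) :
    ∃ F : Subfield ℝ, (∀ i ∈ s, x i ∈ F) ∧ (∀ z : ℝ, IsAlgebraic F z → z ∈ F) ∧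
      AlgebraicIndependent F (fun i : ↥sᶜ => x i) := by
  let F₀ := IntermediateField.adjoin ℚ (x '' s)
  let F₁ := algebraicClosure F₀ ℝ
  have h0 : AlgebraicIndependent F₀ (fun i : ↥sᶜ => x i) :=
    IntermediateField.algebraicIndependent_adjoin_iff.2 (hx.adjoin_of_disjoint disjoint_compl_right)
  have h1 : AlgebraicIndependent F₁ (fun i : ↥sᶜ => x i) := h0.algebraicClosure
  refine ⟨F₁.toSubfield, fun i hi => ?_, fun z hz => ?_, h1⟩
  · have : x i ∈ F₀ := IntermediateField.subset_adjoin _ _ ⟨i, hi, rfl⟩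
    exact F₁.algebraMap_mem ⟨x i, this⟩
  · have hz' : IsAlgebraic F₁ z := hz
    have : Algebra.IsAlgebraic F₀ F₁ := algebraicClosure.isAlgebraic F₀ ℝ
    exact mem_algebraicClosure_iff.2 (hz'.restrictScalars F₀)

/-- The eigenvalue is a root of a characteristic polynomial over `F`, hence lies in `F`; the
singular matrix `μ - X` then has a kernel vector over `F`. -/
theorem exists_eigenvector_over_subfield {α : Type*} [Fintype α] [DecidableEq α] (F : Subfield ℝ)
    (hF : ∀ z : ℝ, IsAlgebraic F z → z ∈ F) {X : Matrix α α ℝ} (hX : ∀ i j, X i j ∈ F) {μ : ℝ}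
    {v : α → ℝ} (hv : v ≠ 0) (h : X *ᵥ v = μ • v) :
    μ ∈ F ∧ ∃ w : α → ℝ, w ≠ 0 ∧ (∀ i, w i ∈ F) ∧ X *ᵥ w = μ • w := by
  let X' : Matrix α α F := Matrix.of fun i j => ⟨X i j, hX i j⟩
  have hX' : X = X'.map (algebraMap F ℝ) := by
    ext i j
    rfl
  have hdet : (scalar α μ - X).det = 0 := by
    rw [← exists_mulVec_eq_zero_iff]
    exact ⟨v, hv, by rw [sub_mulVec, h]; simp [scalar_apply, ← smul_one_eq_diagonal, smul_mulVec]⟩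
  have hμ : μ ∈ F := by
    refine hF μ ⟨X'.charpoly, X'.charpoly_monic.ne_zero, ?_⟩
    rw [← eval_charpoly, hX', charpoly_map] at hdet
    rwa [Polynomial.aeval_def, ← Polynomial.eval_map]
  refine ⟨hμ, ?_⟩
  have hdet' : (scalar α (⟨μ, hμ⟩ : F) - X').det = 0 := by
    rw [← eval_charpoly] at hdet ⊢
    rw [hX', charpoly_map, Polynomial.eval_map] at hdet
    have h2 : μ = algebraMap F ℝ ⟨μ, hμ⟩ := rfl
    rw [h2, Polynomial.eval₂_at_apply] at hdet
    exact (map_eq_zero_iff _ (algebraMap F ℝ).injective).1 hdet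
  obtain ⟨w, hw, hw0⟩ := exists_mulVec_eq_zero_iff.2 hdet'
  refine ⟨fun i => (w i : ℝ), fun h0 => hw ?_, fun i => (w i).2, ?_⟩
  · ext i
    exact congrFun h0 i
  · have h2 : X' *ᵥ w = (⟨μ, hμ⟩ : F) • w := by
      rw [sub_mulVec, sub_eq_zero] at hw0
      rw [← hw0]
      simp [scalar_apply, ← smul_one_eq_diagonal, smul_mulVec]
    ext i
    have h3 := congrArg (algebraMap F ℝ) (congrFun h2 i)
    simp only [mulVec, dotProduct, map_sum, map_mul, Pi.smul_apply, smul_eq_mul] at h3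
    exact h3

end AlgebraicIndependence

/-! ### Eigenvectors of principal submatrices -/

section Spectrum
variable {ι : Type*} [Fintype ι]

/-- `v` is supported in `T` and satisfies the eigenvector equation of the principal submatrix. -/
structure IsPrincipalEigen (X : Matrix ι ι ℝ) (T : Finset ι) (μ : ℝ) (v : ι → ℝ) : Prop where
  support : ∀ i, i ∉ T → v i = 0
  eq : ∀ i ∈ T, (X *ᵥ v) i = μ * v i

theorem IsPrincipalEigen.sub_smul {X : Matrix ι ι ℝ} {T : Finset ι} {μ : ℝ} {u v : ι → ℝ}
    (hv : IsPrincipalEigen X T μ v) (hu : IsPrincipalEigen X T μ u) (c : ℝ) :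
    IsPrincipalEigen X T μ (v - c • u) where
  support i hi := by simp [hv.support i hi, hu.support i hi]
  eq i hi := by
    rw [mulVec_sub, mulVec_smul]
    simp only [Pi.sub_apply, Pi.smul_apply, smul_eq_mul, hv.eq i hi, hu.eq i hi]
    ring

theorem mulVec_apply_of_support {X : Matrix ι ι ℝ} {T : Finset ι} {v : ι → ℝ}
    (hv : ∀ i, i ∉ T → v i = 0) (i : ι) :
    (X *ᵥ v) i = ∑ j : {j // j ∈ T}, X i j * v j := by
  rw [Finset.sum_coe_sort T (fun j => X i j * v j)]
  exact (Finset.sum_subset (Finset.subset_univ _) fun j _ hj => by rw [hv j hj, mul_zero]).symm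

theorem IsPrincipalEigen.submatrix {X : Matrix ι ι ℝ} {T : Finset ι} {μ : ℝ} {v : ι → ℝ}
    (hv : IsPrincipalEigen X T μ v) :
    X.submatrix (Subtype.val : {i // i ∈ T} → ι) Subtype.val *ᵥ (fun i : {i // i ∈ T} => v i) =
      μ • (fun i : {i // i ∈ T} => v i) := by
  ext i
  have := hv.eq i i.2
  rw [mulVec_apply_of_support hv.support] at this
  exact this

variable [DecidableEq ι]

theorem IsPrincipalEigen.exists_over_subfield {X : Matrix ι ι ℝ} {T : Finset ι} {μ : ℝ}
    {v : ι → ℝ} (hv : IsPrincipalEigen X T μ v) (hv0 : v ≠ 0) (F : Subfield ℝ)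
    (hF : ∀ z : ℝ, IsAlgebraic F z → z ∈ F) (hX : ∀ i ∈ T, ∀ j ∈ T, X i j ∈ F) :
    μ ∈ F ∧ ∃ w : ι → ℝ, w ≠ 0 ∧ (∀ i, w i ∈ F) ∧ IsPrincipalEigen X T μ w := by
  obtain ⟨hμ, w, hw0, hwF, hw⟩ := exists_eigenvector_over_subfield F hF
    (X := X.submatrix (Subtype.val : {i // i ∈ T} → ι) Subtype.val)
    (fun i j => hX i i.2 j j.2) (v := fun i => v i) (by
      intro h
      apply hv0
      ext i
      by_cases hi : i ∈ T
      · exact congrFun h ⟨i, hi⟩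
      · exact hv.support i hi) hv.submatrix
  let w' : ι → ℝ := fun i => if h : i ∈ T then w ⟨i, h⟩ else 0
  have hw' : ∀ i : {i // i ∈ T}, w' i = w i := fun i => by simp [w']
  have hsupp : ∀ i, i ∉ T → w' i = 0 := fun i hi => by simp [w', hi]
  refine ⟨hμ, w', fun h => hw0 ?_, fun i => ?_, hsupp, fun i hi => ?_⟩
  · ext i
    rw [← hw', h]
    rfl
  · by_cases hi : i ∈ T
    · simpa [w', hi] using hwF ⟨i, hi⟩
    · simp [w', hi]
  · rw [mulVec_apply_of_support hsupp]
    simp only [hw']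
    have := congrFun hw ⟨i, hi⟩
    simpa [mulVec, dotProduct, w', hi] using this

end Spectrum

/-! ### Nonzero eigenvalues at algebraically independent parameters -/

section GenericSpectrum
variable {ι κ : Type*} {A : Matrix ι ι Entry}
  {B : Matrix ι κ Entry} {p : SymParam A → ℝ} {q : Param B → ℝ}

theorem realizeSym_mem_subfield {F : Subfield ℝ} {T : Finset ι}
    (h : ∀ e : SymParam A, (∀ i ∈ e.1, i ∈ T) → p e ∈ F) {i j : ι} (hi : i ∈ T) (hj : j ∈ T) :
    realizeSym A p i j ∈ F := by
  by_cases hs : A i j = Entry.star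
  · simp only [realizeSym, of_apply, hs, dite_true]
    refine h _ fun k hk => ?_
    rcases Sym2.mem_iff.1 hk with rfl | rfl
    · exact hi
    · exact hj
  · rw [realizeSym_conforms A p i j hs]
    exact F.zero_mem

/-- A linear relation over a field between algebraically independent entries of a row is trivial. -/
theorem eq_zero_of_sum_realize_eq_zero {σ τ : Type*} [Finite τ] {F : Subfield ℝ} {x : σ → ℝ}
    (hx : AlgebraicIndependent F x) (T : Finset τ) (star : τ → Prop)
    (φ : {j // j ∈ T ∧ star j} → σ) (hφ : Function.Injective φ) {a : τ → ℝ}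
    (ha : ∀ j, a j.1 = x (φ j)) (ha' : ∀ j, ¬ star j → a j = 0)
    {w : τ → ℝ} (hw : ∀ j, w j ∈ F) (hsum : ∑ j ∈ T, a j * w j = 0) :
    ∀ j ∈ T, star j → w j = 0 := by
  classical
  intro j hj hs
  have hli := (hx.comp φ hφ).linearIndependent
  have : Fintype {j // j ∈ T ∧ star j} := Fintype.ofFinite _
  rw [Fintype.linearIndependent_iff] at hli
  have h1 := hli (fun j => ⟨w j.1, hw j.1⟩) (by
    have h2 : ∀ j : {j // j ∈ T ∧ star j},
        (⟨w j.1, hw j.1⟩ : F) • (x ∘ φ) j = a j.1 * w j.1 := by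
      intro j
      rw [ha j, mul_comm]
      rfl
    rw [Finset.sum_congr rfl fun j _ => h2 j]
    rw [← Finset.sum_filter_of_ne (p := star) (fun j _ h => by
      by_contra hn
      exact h (by rw [ha' j hn, zero_mul]))] at hsum
    rw [← hsum]
    exact (Finset.sum_subtype (T.filter star) (fun j => by simp) (fun j => a j * w j)).symm)
    ⟨j, hj, hs⟩
  exact congrArg Subtype.val h1

/-- `F` contains the parameters with both indices in `T`. Those joining `k` to `T` are distinct and
remain independent over `F`, so row `k` admits no nontrivial relation over `F`. -/
theorem exists_subfield_row [Finite ι] (hp : AlgebraicIndependent ℚ p) (T : Finset ι) {k : ι}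
    (hk : k ∉ T) :
    ∃ F : Subfield ℝ, (∀ z : ℝ, IsAlgebraic F z → z ∈ F) ∧
      (∀ i ∈ T, ∀ j ∈ T, realizeSym A p i j ∈ F) ∧
      ∀ w : ι → ℝ, (∀ i, w i ∈ F) → ∑ j ∈ T, realizeSym A p k j * w j = 0 →
        ∀ j ∈ T, A k j = Entry.star → w j = 0 := by
  obtain ⟨F, h1, h2, h3⟩ := exists_subfield_algebraicIndependent hp
    {e : SymParam A | ∀ i ∈ e.1, i ∈ T}
  refine ⟨F, h2, fun i hi j hj => realizeSym_mem_subfield h1 hi hj, fun w hw hsum => ?_⟩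
  refine eq_zero_of_sum_realize_eq_zero h3 T (fun j => A k j = Entry.star)
    (fun j => ⟨⟨s(k, j.1), k, j.1, rfl, j.2.2⟩, fun h => hk (h k (Sym2.mem_mk_left _ _))⟩) ?_ ?_
    (fun j hj => realizeSym_conforms A p k j hj) hw hsum
  · intro a b hab
    have h4 : s(k, a.1) = s(k, b.1) := congrArg (fun e => e.1.1) hab
    exact Subtype.ext (Sym2.congr_right.1 h4)
  · rintro ⟨j, hj, hs⟩
    simp [realizeSym, hs]

/-- `F` contains the parameters of `A`, over which the entries in each column of `B` are
independent. -/
theorem exists_subfield_input [Fintype ι] (hpq : AlgebraicIndependent ℚ (Sum.elim p q)) :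
    ∃ F : Subfield ℝ, (∀ z : ℝ, IsAlgebraic F z → z ∈ F) ∧ (∀ i j, realizeSym A p i j ∈ F) ∧
      ∀ w : ι → ℝ, (∀ i, w i ∈ F) → w ᵥ* realize B q = 0 →
        ∀ i j, B i j = Entry.star → w i = 0 := by
  obtain ⟨F, h1, h2, h3⟩ := exists_subfield_algebraicIndependent hpq (Set.range Sum.inl)
  refine ⟨F, h2, fun i j => realizeSym_mem_subfield (T := Finset.univ)
    (fun e _ => h1 (Sum.inl e) ⟨e, rfl⟩) (Finset.mem_univ _) (Finset.mem_univ _),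
    fun w hw hsum i j hij => ?_⟩
  refine eq_zero_of_sum_realize_eq_zero h3 Finset.univ (fun i => B i j = Entry.star)
    (fun i => ⟨Sum.inr ⟨(i.1, j), i.2.2⟩, by simp⟩) ?_ ?_
    (a := fun i => realize B q i j) (fun i hi => realize_conforms B q i j hi) hw ?_ i
    (Finset.mem_univ _) hij
  · intro a b hab
    have h4 : (Sum.inr ⟨(a.1, j), a.2.2⟩ : SymParam A ⊕ Param B) = Sum.inr ⟨(b.1, j), b.2.2⟩ :=
      congrArg Subtype.val hab
    exact Subtype.ext (congrArg (fun e : Param B => e.1.1) (Sum.inr_injective h4))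
  · rintro ⟨i, hi, hs⟩
    simp [realize, hs]
  · have := congrFun hsum j
    simpa [vecMul, dotProduct, mul_comm] using this

variable [Fintype ι] [DecidableEq ι]

/-- The parameters within `T` are independent over a field `F` containing those within `S`. For `μ`
in `F`, `det (μ - X_T)` is a polynomial in them over `F` whose value at the origin is `μ ^ |T| ≠ 0`,
so it does not vanish. Principal submatrices on disjoint index sets thus share no nonzero
eigenvalue. -/
theorem exists_subfield_disjoint (hp : AlgebraicIndependent ℚ p) {S T : Finset ι}
    (hST : Disjoint S T) :
    ∃ F : Subfield ℝ, (∀ z : ℝ, IsAlgebraic F z → z ∈ F) ∧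
      (∀ i ∈ S, ∀ j ∈ S, realizeSym A p i j ∈ F) ∧
      ∀ μ ∈ F, μ ≠ 0 → ∀ u, IsPrincipalEigen (realizeSym A p) T μ u → u = 0 := by
  classical
  let s : Set (SymParam A) := {e | ∀ i ∈ e.1, i ∈ S}
  obtain ⟨F, h1, h2, h3⟩ := exists_subfield_algebraicIndependent hp s
  refine ⟨F, h2, fun i hi j hj => realizeSym_mem_subfield h1 hi hj, fun μ hμ hμ0 u hu => ?_⟩
  have hsc : ∀ (i j : {i // i ∈ T}) (h : A i j = Entry.star),
      (⟨s(i.1, j.1), i, j, rfl, h⟩ : SymParam A) ∈ sᶜ := fun i j h hs =>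
    Finset.disjoint_left.1 hST (hs i (Sym2.mem_mk_left _ _)) i.2
  let G : Matrix {i // i ∈ T} {i // i ∈ T} (MvPolynomial (↥sᶜ) F) := Matrix.of fun i j =>
    if h : A i j = Entry.star then MvPolynomial.X ⟨_, hsc i j h⟩ else 0
  let H := scalar {i // i ∈ T} (MvPolynomial.C ⟨μ, hμ⟩) - G
  have hev : H.map (MvPolynomial.aeval (fun i : ↥sᶜ => p i)) =
      scalar {i // i ∈ T} μ - (realizeSym A p).submatrix Subtype.val Subtype.val := by
    ext i j
    by_cases hs : A i j = Entry.star
    · by_cases hij : i = j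
      · subst hij
        simp [H, G, hs, realizeSym]
        rfl
      · simp [H, G, hs, realizeSym, hij]
    · by_cases hij : i = j
      · subst hij
        simp [H, G, hs, realizeSym]
        rfl
      · simp [H, G, hs, realizeSym, hij]
  have hz : H.map (MvPolynomial.aeval (fun _ : ↥sᶜ => (0 : F))) =
      scalar {i // i ∈ T} (⟨μ, hμ⟩ : F) := by
    ext i j
    by_cases hs : A i j = Entry.star
    · by_cases hij : i = j
      · subst hij
        simp [H, G, hs]
      · simp [H, G, hs, hij]
    · by_cases hij : i = j
      · subst hij
        simp [H, G, hs]
      · simp [H, G, hs, hij]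
  have hdet : (scalar {i // i ∈ T} μ -
      (realizeSym A p).submatrix Subtype.val Subtype.val).det ≠ 0 := by
    rw [← hev]
    have e1 := (MvPolynomial.aeval (fun i : ↥sᶜ => p i) : _ →ₐ[F] ℝ).toRingHom.map_det H
    have e2 := (MvPolynomial.aeval (fun _ : ↥sᶜ => (0 : F)) : _ →ₐ[F] F).toRingHom.map_det H
    intro h0
    have e3 : H.det = 0 := h3.eq_zero_of_aeval_eq_zero _ (e1.trans h0)
    rw [e3, map_zero] at e2
    have e4 : (scalar {i // i ∈ T} (⟨μ, hμ⟩ : F)).det = 0 := by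
      rw [← hz]
      exact e2.symm
    rw [scalar_apply, det_diagonal, Finset.prod_const] at e4
    exact pow_ne_zero _ (fun h => hμ0 (congrArg Subtype.val h)) e4
  by_contra hu0
  refine hdet (exists_mulVec_eq_zero_iff.1 ⟨fun i => u i, fun h => hu0 ?_, ?_⟩)
  · ext i
    by_cases hi : i ∈ T
    · exact congrFun h ⟨i, hi⟩
    · exact hu.support i hi
  · rw [sub_mulVec, hu.submatrix]
    simp [scalar_apply, ← smul_one_eq_diagonal, smul_mulVec]

/-- Nonzero eigenvalues of principal submatrices with algebraically independent entries are
simple. -/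
theorem principalEigen_simple_and_propagates (hp : AlgebraicIndependent ℚ p)
    (T : Finset ι) {μ : ℝ} (hμ : μ ≠ 0) :
    (∀ u v, IsPrincipalEigen (realizeSym A p) T μ u → IsPrincipalEigen (realizeSym A p) T μ v →
      ∀ k, u k ≠ 0 → v k = 0 → v = 0) ∧
    (∀ v, IsPrincipalEigen (realizeSym A p) T μ v → ∀ k ∈ T, v k = 0 →
      ∀ j ∈ T, A k j = Entry.star → v j = 0) := by
  classical
  induction T using Finset.strongInduction with
  | H T ih =>
  -- If `v k = 0`, then `v` is an eigenvector on `T.erase k`, hence by the induction hypothesis a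
  -- multiple of some `w` with coordinates in the field of that submatrix. Row `k` becomes a
  -- relation over this field between independent entries.
  have hprop : ∀ v, IsPrincipalEigen (realizeSym A p) T μ v → ∀ k ∈ T, v k = 0 →
      ∀ j ∈ T, A k j = Entry.star → v j = 0 := by
    intro v hv k hk hvk j hj hkj
    by_cases hv0 : v = 0
    · rw [hv0]; rfl
    obtain ⟨hsimple, -⟩ := ih (T.erase k) (Finset.erase_ssubset hk)
    have hv' : IsPrincipalEigen (realizeSym A p) (T.erase k) μ v := by
      refine ⟨fun i hi => ?_, fun i hi => hv.eq i (Finset.mem_of_mem_erase hi)⟩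
      by_cases hik : i = k
      · rw [hik, hvk]
      · exact hv.support i fun h => hi (Finset.mem_erase.2 ⟨hik, h⟩)
    obtain ⟨F, hF, hXF, hrow⟩ := exists_subfield_row hp (T.erase k) (Finset.notMem_erase k T)
    obtain ⟨-, w, hw0, hwF, hw⟩ := hv'.exists_over_subfield hv0 F hF hXF
    obtain ⟨l, hl⟩ : ∃ l, w l ≠ 0 := by
      by_contra h
      push Not at h
      exact hw0 (funext h)
    have hvl : v l ≠ 0 := fun h => hv0 (hsimple w v hw hv' l hl h)
    have hvw : v - (v l / w l) • w = 0 := by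
      refine hsimple w _ hw (hv'.sub_smul hw _) l hl ?_
      simp [hl]
    rw [sub_eq_zero] at hvw
    by_cases hjk : j = k
    · rw [hjk, hvk]
    have hsum : (v l / w l) * ∑ j ∈ T.erase k, realizeSym A p k j * w j = 0 := by
      have h1 := hv.eq k hk
      rw [hvk, mul_zero, mulVec_apply_of_support hv'.support,
        Finset.sum_coe_sort (T.erase k) (fun j => realizeSym A p k j * v j)] at h1
      rw [← h1, Finset.mul_sum]
      refine Finset.sum_congr rfl fun j _ => ?_
      have : v j = v l / w l * w j := congrFun hvw j
      rw [this]
      ring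
    have h2 := hrow w hwF ((mul_eq_zero.1 hsum).resolve_left (div_ne_zero hvl hl)) j
      (Finset.mem_erase.2 ⟨hjk, hj⟩) hkj
    rw [hvw, Pi.smul_apply, h2, smul_zero]
  refine ⟨fun u v hu hv k huk hvk => ?_, hprop⟩
  by_contra hv0
  -- By propagation no star leads from the zero set `Z` of `v` to its support `S`, so `u` restricted
  -- to `Z` is an eigenvector there, nonzero at `k`. Then `S` and `Z` would share the eigenvalue
  -- `μ`.
  let S := T.filter fun i => v i ≠ 0
  let Z := T.filter fun i => v i = 0
  have hdisj : Disjoint S Z := by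
    rw [Finset.disjoint_left]
    intro i hi hi'
    exact (Finset.mem_filter.1 hi).2 (Finset.mem_filter.1 hi').2
  have hvS : IsPrincipalEigen (realizeSym A p) S μ v := by
    refine ⟨fun i hi => ?_, fun i hi => hv.eq i (Finset.mem_filter.1 hi).1⟩
    by_contra hn
    by_cases hiT : i ∈ T
    · exact hi (Finset.mem_filter.2 ⟨hiT, hn⟩)
    · exact hn (hv.support i hiT)
  have huZ : IsPrincipalEigen (realizeSym A p) Z μ (fun i => if i ∈ Z then u i else 0) := by
    refine ⟨fun i hi => if_neg hi, fun i hi => ?_⟩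
    have hiT := (Finset.mem_filter.1 hi).1
    rw [if_pos hi, ← hu.eq i hiT]
    simp only [mulVec, dotProduct]
    refine Finset.sum_congr rfl fun j _ => ?_
    by_cases hj : j ∈ Z
    · rw [if_pos hj]
    · rw [if_neg hj]
      by_cases hjT : j ∈ T
      · rw [realizeSym_conforms A p i j fun hs => hj (Finset.mem_filter.2
          ⟨hjT, hprop v hv i hiT (Finset.mem_filter.1 hi).2 j hjT hs⟩), zero_mul, zero_mul]
      · rw [hu.support j hjT]
  obtain ⟨F, hF, hXF, hnone⟩ := exists_subfield_disjoint hp hdisj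
  have hμF := (hvS.exists_over_subfield hv0 F hF hXF).1
  have h0 := congrFun (hnone μ hμF hμ _ huZ) k
  have hkT : k ∈ T := by
    by_contra hn
    exact huk (hu.support k hn)
  simp only [Z, Finset.mem_filter, hkT, hvk, and_self, if_true, Pi.zero_apply] at h0
  exact huk h0

/-- `Z` contains the states with an edge from an input and is closed under edges of the state
digraph. -/
structure IsClosedStates {ι κ : Type*} (A : Matrix ι ι Entry) (B : Matrix ι κ Entry)
    (Z : Set ι) : Prop where
  input : ∀ i j, B i j = Entry.star → i ∈ Z
  step : ∀ i j, A i j = Entry.star → j ∈ Z → i ∈ Z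

/-- Simplicity allows rescaling `v` to coordinates in the field of `A`; orthogonality to the
independent entries of `B` makes it vanish at the states fed by an input, and zeros propagate along
edges. The zero set is closed, hence everything. -/
theorem eigenvector_eq_zero_of_vecMul_eq_zero (hA : A.IsSymm)
    (hpq : AlgebraicIndependent ℚ (Sum.elim p q))
    (hcl : ∀ Z : Set ι, IsClosedStates A B Z → Z = Set.univ) {μ : ℝ} (hμ : μ ≠ 0) {v : ι → ℝ}
    (hv : realizeSym A p *ᵥ v = μ • v) (hvB : v ᵥ* realize B q = 0) : v = 0 := by
  by_contra hv0
  have hp : AlgebraicIndependent ℚ p := hpq.comp Sum.inl Sum.inl_injective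
  have hve : IsPrincipalEigen (realizeSym A p) Finset.univ μ v :=
    ⟨fun i hi => absurd (Finset.mem_univ i) hi, fun i _ => congrFun hv i⟩
  obtain ⟨hsimple, hprop⟩ := principalEigen_simple_and_propagates hp Finset.univ hμ
  obtain ⟨F, hF, hXF, hin⟩ := exists_subfield_input hpq
  obtain ⟨-, w, hw0, hwF, hw⟩ := hve.exists_over_subfield hv0 F hF fun i _ j _ => hXF i j
  obtain ⟨l, hl⟩ : ∃ l, v l ≠ 0 := by
    by_contra h
    push Not at h
    exact hv0 (funext h)
  have hwv : w - (w l / v l) • v = 0 := by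
    refine hsimple v _ hve (hw.sub_smul hve _) l hl ?_
    simp [hl]
  have hwl : w l ≠ 0 := fun h => hw0 (hsimple v w hve hw l hl h)
  rw [sub_eq_zero] at hwv
  have hwB : w ᵥ* realize B q = 0 := by rw [hwv, smul_vecMul, hvB, smul_zero]
  have hZ := hcl {i | v i = 0} ⟨fun i j hij => ?_, fun i j hij hj => ?_⟩
  · exact hl (hZ ▸ Set.mem_univ l : l ∈ {i | v i = 0})
  · have h1 := hin w hwF hwB i j hij
    rw [hwv, Pi.smul_apply, smul_eq_mul] at h1
    exact (mul_eq_zero.1 h1).resolve_left (div_ne_zero hwl hl)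
  · exact hprop v hve j (Finset.mem_univ _) hj i (Finset.mem_univ _) (by rw [← hij, hA.apply])

end GenericSpectrum

/-! ### From uncontrollable modes to the rank of the controllability matrix -/

section Controllability
variable {n m : ℕ}

/-- Let `ξ` be in the left kernel of the controllability matrix. Each spectral component of `ξ` is a
polynomial in `X` applied to `ξ`, hence orthogonal to the columns of `Y`; by hypothesis it vanishes
for nonzero eigenvalues. So `Xξ = 0`, and `ξ` kills `[X, Y]`. -/
theorem rank_fromCols_le_rank_ctrbMatrix {X : Matrix (Fin n) (Fin n) ℝ}
    {Y : Matrix (Fin n) (Fin m) ℝ} (hX : X.IsSymm)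
    (h : ∀ μ : ℝ, μ ≠ 0 → ∀ v : Fin n → ℝ, X *ᵥ v = μ • v → v ᵥ* Y = 0 → v = 0) :
    (fromCols X Y).rank ≤ (ctrbMatrix X Y).rank := by
  suffices hker : LinearMap.ker (ctrbMatrix X Y).vecMulLinear ≤
      LinearMap.ker (fromCols X Y).vecMulLinear by
    have h1 := finrank_ker_vecMulLinear_add_rank (ctrbMatrix X Y)
    have h2 := finrank_ker_vecMulLinear_add_rank (fromCols X Y)
    have h3 := Submodule.finrank_mono hker
    omega
  intro ξ hξ
  have hξ' : ∀ k < n, ξ ᵥ* (X ^ k * Y) = 0 := by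
    intro k hk
    ext j
    exact congrFun (LinearMap.mem_ker.1 hξ) (⟨k, hk⟩, j)
  obtain ⟨μ, b, hb, hexp⟩ := exists_eigenvector_expansion hX
  set c : Fin n → ℝ := fun i => b i ⬝ᵥ ξ
  have hpow : ∀ k, X ^ k *ᵥ ξ = ∑ i, (c i * μ i ^ k) • b i := by
    intro k
    induction k with
    | zero => simpa using hexp ξ
    | succ k ih =>
      rw [pow_succ', ← mulVec_mulVec, ih, mulVec_sum]
      refine Finset.sum_congr rfl fun i _ => ?_
      rw [mulVec_smul, hb, smul_smul, pow_succ, mul_assoc]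
  have hzero : ∀ ν : ℝ, ν ≠ 0 → ∑ i with μ i = ν, c i • b i = 0 := by
    intro ν hν
    refine h ν hν _ ?_ ?_
    · rw [mulVec_sum, Finset.smul_sum]
      refine Finset.sum_congr rfl fun i hi => ?_
      rw [mulVec_smul, hb, (Finset.mem_filter.1 hi).2, smul_comm]
    · let s := Finset.univ.image μ
      -- `P` is the indicator of `ν` on the spectrum. With at most `n` nodes its degree is below
      -- `n`, so `P(X) ξ` uses only the powers occurring in the controllability matrix.
      let P := Lagrange.interpolate s id (fun x => if x = ν then (1 : ℝ) else 0)
      have hP : ∀ i, P.eval (μ i) = if μ i = ν then 1 else 0 := fun i =>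
        Lagrange.eval_interpolate_at_node _ Function.injective_id.injOn
          (Finset.mem_image_of_mem μ (Finset.mem_univ i))
      have hdeg : P.degree < n := by
        refine (Lagrange.degree_interpolate_lt _ Function.injective_id.injOn).trans_le ?_
        have : s.card ≤ n := Finset.card_image_le.trans_eq (by simp)
        exact_mod_cast this
      have hevalP : ∀ x, P.eval x = ∑ k ∈ Finset.range n, P.coeff k * x ^ k := by
        intro x
        by_cases hP0 : P = 0
        · simp [hP0]
        · exact Polynomial.eval_eq_sum_range' ((Polynomial.natDegree_lt_iff_degree_lt hP0).2 hdeg) x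
      have hζ : ∑ i with μ i = ν, c i • b i =
          ∑ k ∈ Finset.range n, P.coeff k • (X ^ k *ᵥ ξ) := by
        simp only [hpow, Finset.smul_sum, smul_smul]
        rw [Finset.sum_comm, Finset.sum_filter]
        refine Finset.sum_congr rfl fun i _ => ?_
        rw [← Finset.sum_smul]
        have h1 : ∑ k ∈ Finset.range n, P.coeff k * (c i * μ i ^ k) = c i * P.eval (μ i) := by
          rw [hevalP, Finset.mul_sum]
          exact Finset.sum_congr rfl fun k _ => by ring
        rw [h1, hP]
        split_ifs <;> simp
      rw [hζ, sum_vecMul]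
      refine Finset.sum_eq_zero fun k hk => ?_
      rw [smul_vecMul, ← vecMul_transpose, transpose_pow, hX.eq, vecMul_vecMul,
        hξ' k (Finset.mem_range.1 hk), smul_zero]
  have hXξ : X *ᵥ ξ = 0 := by
    have h1 := hpow 1
    rw [pow_one] at h1
    rw [h1, ← Finset.sum_fiberwise_of_maps_to (t := Finset.univ.image μ)
      (fun i _ => Finset.mem_image_of_mem μ (Finset.mem_univ i))]
    refine Finset.sum_eq_zero fun ν _ => ?_
    have h2 : ∑ i with μ i = ν, (c i * μ i ^ 1) • b i = ν • ∑ i with μ i = ν, c i • b i := by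
      rw [Finset.smul_sum]
      refine Finset.sum_congr rfl fun i hi => ?_
      rw [(Finset.mem_filter.1 hi).2, smul_smul, pow_one, mul_comm]
    rw [h2]
    by_cases hν : ν = 0
    · rw [hν, zero_smul]
    · rw [hzero ν hν, smul_zero]
  have hYξ : ξ ᵥ* Y = 0 := by
    rcases Nat.eq_zero_or_pos n with rfl | hn
    · ext j
      simp [vecMul, dotProduct]
    · simpa using hξ' 0 hn
  rw [LinearMap.mem_ker, vecMulLinear_apply, vecMul_fromCols, hYξ, ← hX.eq, vecMul_transpose, hXξ]
  ext (k | k) <;> rfl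

end Controllability

/-! ### Matrices of indeterminates -/

section GenericPolynomials

variable {ι κ : Type*} (A : Matrix ι ι Entry) (B : Matrix ι κ Entry) (R : Type*) [CommRing R]

open Classical in
/-- The symmetric matrix of indeterminates with a given pattern. -/
noncomputable def genericSym : Matrix ι ι (MvPolynomial (SymParam A ⊕ Param B) R) :=
  Matrix.of fun i j =>
    if h : A i j = Entry.star then MvPolynomial.X (Sum.inl ⟨s(i, j), i, j, rfl, h⟩) else 0

open Classical in
/-- The matrix of indeterminates with a given pattern. -/
noncomputable def genericInput : Matrix ι κ (MvPolynomial (SymParam A ⊕ Param B) R) :=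
  Matrix.of fun i j =>
    if h : B i j = Entry.star then MvPolynomial.X (Sum.inr ⟨(i, j), h⟩) else 0

variable [Algebra R ℝ] (p : SymParam A → ℝ) (q : Param B → ℝ)

theorem genericSym_map :
    (genericSym A B R).map (MvPolynomial.aeval (Sum.elim p q)) = realizeSym A p := by
  ext i j
  by_cases h : A i j = Entry.star <;> simp [genericSym, realizeSym, h]

theorem genericInput_map :
    (genericInput A B R).map (MvPolynomial.aeval (Sum.elim p q)) = realize B q := by
  ext i j
  by_cases h : B i j = Entry.star <;> simp [genericInput, realize, h]

end GenericPolynomials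

/-! ### Generic controllable dimension and term rank -/

section GenericDimension
variable {n m : ℕ} {A : Matrix (Fin n) (Fin n) Entry} {B : Matrix (Fin n) (Fin m) Entry}

/-- A minor that is nonzero at some realization is a nonzero polynomial over `ℚ`, so it does not
vanish at algebraically independent parameters. -/
theorem rank_fromCols_le_of_algebraicIndependent (p₀ : SymParam A → ℝ) (q₀ : Param B → ℝ)
    {p : SymParam A → ℝ} {q : Param B → ℝ} (h : AlgebraicIndependent ℚ (Sum.elim p q)) :
    (fromCols (realizeSym A p₀) (realize B q₀)).rank ≤
      (fromCols (realizeSym A p) (realize B q)).rank := by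
  obtain ⟨r, c, hd⟩ := exists_submatrix_det_ne_zero (fromCols (realizeSym A p₀) (realize B q₀))
  let G := (fromCols (genericSym A B ℚ) (genericInput A B ℚ)).submatrix r c
  have hG : ∀ p q, MvPolynomial.aeval (Sum.elim p q) G.det =
      ((fromCols (realizeSym A p) (realize B q)).submatrix r c).det := by
    intro p q
    refine ((MvPolynomial.aeval (Sum.elim p q) : _ →ₐ[ℚ] ℝ).toRingHom.map_det G).trans ?_
    congr 1
    rw [← genericSym_map A B ℚ p q, ← genericInput_map A B ℚ p q]
    ext i j
    rcases hc : c j with k | k <;> simp [G, hc]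
  have hne : G.det ≠ 0 := by
    intro h0
    have := hG p₀ q₀
    rw [h0, map_zero] at this
    exact hd this.symm
  have h1 := le_rank_of_submatrix_det_ne_zero (fromCols (realizeSym A p) (realize B q)) r c (by
    rw [← hG p q]
    exact fun h0 => hne (h.eq_zero_of_aeval_eq_zero _ h0))
  simpa using h1

theorem exists_tRank_le_rank_ctrbMatrix (hA : A.IsSymm)
    (hcl : ∀ Z : Set (Fin n), IsClosedStates A B Z → Z = Set.univ) :
    ∃ p q, tRank (fromCols A B) ≤ (ctrbMatrix (realizeSym A p) (realize B q)).rank := by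
  classical
  obtain ⟨X, Y, hXs, hX, hY, hr⟩ := exists_conforming_tRank_le_rank (B := B) hA
  obtain ⟨p₀, rfl⟩ := hX.exists_realizeSym hXs
  obtain ⟨q₀, rfl⟩ := hY.exists_realize
  obtain ⟨x, hx⟩ := exists_algebraicIndependent_real (SymParam A ⊕ Param B)
  have hx' : AlgebraicIndependent ℚ (Sum.elim (x ∘ Sum.inl) (x ∘ Sum.inr)) := by
    rwa [Sum.elim_comp_inl_inr]
  refine ⟨x ∘ Sum.inl, x ∘ Sum.inr,
    hr.trans ((rank_fromCols_le_of_algebraicIndependent p₀ q₀ hx').trans ?_)⟩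
  exact rank_fromCols_le_rank_ctrbMatrix (realizeSym_isSymm hA _) fun μ hμ v hv hvB =>
    eigenvector_eq_zero_of_vecMul_eq_zero hA hx' hcl hμ hv hvB

theorem finrank_stabilizableSubspace_le_tRank (p : SymParam A → ℝ) (q : Param B → ℝ) :
    Module.finrank ℝ (stabilizableSubspace (realizeSym A p) (realize B q)) ≤
      tRank (fromCols A B) :=
  finrank_stabilizableSubspace_le_rank.trans
    ((realizeSym_conforms A p).fromCols (realize_conforms B q)).rank_le_tRank

theorem mDim_eq_tRank (hA : A.IsSymm)
    (hcl : ∀ Z : Set (Fin n), IsClosedStates A B Z → Z = Set.univ) :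
    mDim A B = tRank (fromCols A B) := by
  refine le_antisymm ?_ ?_
  · obtain ⟨p, q, h⟩ := (mDim_isGreatest A B).1
    rw [h]
    exact finrank_stabilizableSubspace_le_tRank p q
  · obtain ⟨p, q, h⟩ := exists_tRank_le_rank_ctrbMatrix hA hcl
    exact (h.trans rank_ctrbMatrix_le_finrank_stabilizableSubspace).trans
      ((mDim_isGreatest A B).2 ⟨p, q, rfl⟩)

/-- Outside the zero set of a nonzero polynomial, the controllability matrix has rank at least the
rank at a given point. -/
theorem exists_polynomial_rank_ctrbMatrix_le (p₀ : SymParam A → ℝ) (q₀ : Param B → ℝ) :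
    ∃ f : MvPolynomial (SymParam A ⊕ Param B) ℝ, MvPolynomial.eval (Sum.elim p₀ q₀) f ≠ 0 ∧
      ∀ p q, MvPolynomial.eval (Sum.elim p q) f ≠ 0 →
        (ctrbMatrix (realizeSym A p₀) (realize B q₀)).rank ≤
          (ctrbMatrix (realizeSym A p) (realize B q)).rank := by
  obtain ⟨r, c, hd⟩ := exists_submatrix_det_ne_zero (ctrbMatrix (realizeSym A p₀) (realize B q₀))
  let C : Matrix (Fin n) (Fin n × Fin m) (MvPolynomial (SymParam A ⊕ Param B) ℝ) :=
    Matrix.of fun i kj => (genericSym A B ℝ ^ (kj.1 : ℕ) * genericInput A B ℝ) i kj.2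
  have hG : ∀ p q, MvPolynomial.eval (Sum.elim p q) (C.submatrix r c).det =
      ((ctrbMatrix (realizeSym A p) (realize B q)).submatrix r c).det := by
    intro p q
    rw [RingHom.map_det]
    congr 1
    have h1 : (genericSym A B ℝ).map (MvPolynomial.eval (Sum.elim p q)) = realizeSym A p :=
      genericSym_map A B ℝ p q
    have h2 : (genericInput A B ℝ).map (MvPolynomial.eval (Sum.elim p q)) = realize B q :=
      genericInput_map A B ℝ p q
    ext i j
    have h3 : ((genericSym A B ℝ ^ ((c j).1 : ℕ) * genericInput A B ℝ).map
        (MvPolynomial.eval (Sum.elim p q))) =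
          realizeSym A p ^ ((c j).1 : ℕ) * realize B q := by
      rw [Matrix.map_mul, h2, ← h1]
      congr 1
      exact map_pow (MvPolynomial.eval (Sum.elim p q)).mapMatrix _ _
    exact congrFun (congrFun h3 (r i)) (c j).2
  refine ⟨(C.submatrix r c).det, by rwa [hG], fun p q h => ?_⟩
  rw [hG] at h
  simpa using le_rank_of_submatrix_det_ne_zero _ r c h

theorem isGenericCtrbDim_iff (hA : A.IsSymm)
    (hcl : ∀ Z : Set (Fin n), IsClosedStates A B Z → Z = Set.univ) (d : ℕ) :
    IsGenericCtrbDim A B d ↔ d = tRank (fromCols A B) := by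
  obtain ⟨p₀, q₀, h₀⟩ := exists_tRank_le_rank_ctrbMatrix hA hcl
  obtain ⟨f, hf₀, hf⟩ := exists_polynomial_rank_ctrbMatrix_le p₀ q₀
  have hrank : ∀ p q, MvPolynomial.eval (Sum.elim p q) f ≠ 0 →
      (ctrbMatrix (realizeSym A p) (realize B q)).rank = tRank (fromCols A B) := fun p q h =>
    le_antisymm (rank_ctrbMatrix_le_finrank_stabilizableSubspace.trans
      (finrank_stabilizableSubspace_le_tRank p q)) (h₀.trans (hf p q h))
  constructor
  · rintro ⟨V, ⟨k, φ, rfl⟩, hV, hd⟩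
    obtain ⟨x, hx⟩ := (Set.ne_univ_iff_exists_notMem _).1 hV
    rw [Set.mem_ofPred_eq] at hx
    push Not at hx
    obtain ⟨i, hi⟩ := hx
    -- A proper variety omits the nonvanishing set of one of its equations. A point where neither `φ
    -- i` nor `f` vanishes is generic in both senses and forces the two dimensions to agree.
    have h1 : φ i * f ≠ 0 := by
      refine mul_ne_zero ?_ ?_
      · rintro h; rw [h, map_zero] at hi; exact hi rfl
      · rintro h; rw [h, map_zero] at hf₀; exact hf₀ rfl
    obtain ⟨y, hy⟩ : ∃ y, MvPolynomial.eval y (φ i * f) ≠ 0 := by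
      by_contra h
      push Not at h
      exact h1 (MvPolynomial.funext fun y => by rw [h y, map_zero])
    rw [map_mul] at hy
    have hy' : Sum.elim (y ∘ Sum.inl) (y ∘ Sum.inr) = y := Sum.elim_comp_inl_inr y
    rw [← hd (y ∘ Sum.inl) (y ∘ Sum.inr), hrank]
    · rw [hy']; exact right_ne_zero_of_mul hy
    · rw [hy']; exact fun h => left_ne_zero_of_mul hy (h i)
  · rintro rfl
    refine ⟨{x | ∀ _ : Fin 1, MvPolynomial.eval x f = 0}, ⟨1, fun _ => f, rfl⟩, fun h => ?_,
      fun p q h => hrank p q fun h0 => h fun _ => h0⟩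
    have : Sum.elim p₀ q₀ ∈ {x | ∀ _ : Fin 1, MvPolynomial.eval x f = 0} := h ▸ Set.mem_univ _
    exact hf₀ (this 0)

end GenericDimension

/-! ### Negative definite forms on cycles -/

section Cycles

/-- Consecutive edges pair up to `(2 d₀ - d_{i+1})(d_{i+1} - d_i)`, which telescopes up to a sum of
squares of differences. This is the open-path part of the form on an odd cycle. -/
theorem sum_alternating_cycle (d : ℕ → ℝ) (r : ℕ) :
    ∑ t ∈ Finset.range (2 * r), (if Even t then (-1 : ℝ) else 1) *
      ((if Even t then d (t / 2) else 2 * d 0 - d ((t + 1) / 2)) *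
        (if Even (t + 1) then d ((t + 1) / 2) else 2 * d 0 - d ((t + 1 + 1) / 2))) =
      2 * d 0 * (d r - d 0) - (d r ^ 2 - d 0 ^ 2) / 2 -
        (∑ i ∈ Finset.range r, (d (i + 1) - d i) ^ 2) / 2 := by
  induction r with
  | zero => simp
  | succ r ih =>
    have h0 : Even (2 * r) := even_two_mul r
    have h1 : ¬ Even (2 * r + 1) := by simp
    have h2 : Even (2 * r + 1 + 1) := ⟨r + 1, by ring⟩
    have e1 : 2 * r / 2 = r := by omega
    have e2 : (2 * r + 1) / 2 = r := by omega
    have e3 : (2 * r + 1 + 1) / 2 = r + 1 := by omega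
    rw [mul_add, mul_one, Finset.sum_range_succ, Finset.sum_range_succ, ih, Finset.sum_range_succ]
    simp only [h0, h1, h2, e1, e3, if_true, if_false]
    ring

/-- A cycle of length `l` carries weights whose quadratic form is negative definite on a space of
dimension `(l + 1) / 2`, rounded down. -/
theorem exists_negDef_cycle (l : ℕ) (hl : 0 < l) :
    ∃ (w : Fin l → ℝ) (Ψ : (Fin ((l + 1) / 2) → ℝ) →ₗ[ℝ] (Fin l → ℝ)),
      ∀ c, c ≠ 0 → ∑ t, w t * (Ψ c t * Ψ c (finRotate l t)) < 0 := by
  rcases Nat.even_or_odd' l with ⟨r, rfl | rfl⟩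
  · have hr : (2 * r + 1) / 2 = r := by omega
    rw [hr]
    -- For even length, use every other edge as a perfect matching and put `(c, -c)` on its ends;
    -- the form is `-∑ c²`.
    let Ψ : (Fin r → ℝ) →ₗ[ℝ] (Fin (2 * r) → ℝ) :=
      LinearMap.pi fun t => (if Even t.1 then (1 : ℝ) else -1) •
        LinearMap.proj (⟨t.1 / 2, by omega⟩ : Fin r)
    refine ⟨fun t => if Even t.1 then 1 else 0, Ψ, fun c hc => ?_⟩
    have hterm : ∀ t : Fin (2 * r), Even t.1 →
        Ψ c t * Ψ c (finRotate (2 * r) t) = -(c ⟨t.1 / 2, by omega⟩) ^ 2 := by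
      intro t ht
      have h1 : t.1 + 1 < 2 * r := by
        obtain ⟨a, ha⟩ := ht
        omega
      have h2 : finRotate (2 * r) t = ⟨t.1 + 1, h1⟩ := by
        obtain ⟨N, hN⟩ : ∃ N, 2 * r = N + 1 := ⟨2 * r - 1, by omega⟩
        revert t
        rw [hN]
        intro t ht h1
        exact finRotate_of_lt (by omega)
      have h3 : ¬ Even (t.1 + 1) := by
        rw [Nat.not_even_iff_odd]
        exact ht.add_one
      have h4 : (⟨(t.1 + 1) / 2, by omega⟩ : Fin r) = ⟨t.1 / 2, by omega⟩ := by
        obtain ⟨a, ha⟩ := ht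
        ext
        simp only
        omega
      rw [h2]
      simp [Ψ, ht, h3, h4]
      ring
    refine Finset.sum_neg' (fun t _ => ?_) ?_
    · dsimp only
      by_cases ht : Even t.1
      · rw [if_pos ht, hterm t ht]
        have := sq_nonneg (c ⟨t.1 / 2, by omega⟩)
        linarith
      · rw [if_neg ht, zero_mul]
    · obtain ⟨i, hi⟩ := Function.ne_iff.1 hc
      refine ⟨⟨2 * i.1, by omega⟩, Finset.mem_univ _, ?_⟩
      have he : Even (2 * i.1) := even_two_mul _
      have h1 : (⟨2 * i.1 / 2, by omega⟩ : Fin r) = i := by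
        ext
        simp
      rw [hterm _ he]
      simp only [he, if_true, h1, one_mul]
      have := sq_pos_of_ne_zero hi
      linarith
  · have hr : (2 * r + 1 + 1) / 2 = r + 1 := by omega
    rw [hr]
    let dl : ℕ → ((Fin (r + 1) → ℝ) →ₗ[ℝ] ℝ) := fun i =>
      if h : i < r + 1 then LinearMap.proj (⟨i, h⟩ : Fin (r + 1)) else 0
    -- For odd length, the weights alternate beginning and ending with `-1`. With this choice the
    -- closing edge `-d_r d_0` completes the path sum to `-d_0² - (d_r - d_0)²/2 - ∑ (d_{i+1} -
    -- d_i)²/2`, negative definite in `d_0, …, d_r`. A self-loop is the case `r = 0`.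
    let yl : ℕ → ((Fin (r + 1) → ℝ) →ₗ[ℝ] ℝ) := fun t =>
      if Even t then dl (t / 2) else (2 : ℝ) • dl 0 - dl ((t + 1) / 2)
    refine ⟨fun t => if Even t.1 then -1 else 1, LinearMap.pi fun t => yl t.1, fun c hc => ?_⟩
    set d : ℕ → ℝ := fun i => dl i c
    have hy : ∀ t, yl t c = if Even t then d (t / 2) else 2 * d 0 - d ((t + 1) / 2) := by
      intro t
      by_cases ht : Even t <;> simp [yl, ht, d]
    simp only [LinearMap.pi_apply]
    rw [Fin.sum_univ_castSucc]
    have hrot : ∀ t : Fin (2 * r), (finRotate (2 * r + 1) t.castSucc).1 = t.1 + 1 := by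
      intro t
      have := finRotate_of_lt (n := 2 * r) (k := t.1) t.2
      exact congrArg Fin.val this
    have hlast : (finRotate (2 * r + 1) (Fin.last (2 * r))).1 = 0 := by simp
    have hsum : ∑ t : Fin (2 * r), (if Even (t.castSucc).1 then (-1 : ℝ) else 1) *
        (yl t.castSucc.1 c * yl (finRotate (2 * r + 1) t.castSucc).1 c) =
        2 * d 0 * (d r - d 0) - (d r ^ 2 - d 0 ^ 2) / 2 -
        (∑ i ∈ Finset.range r, (d (i + 1) - d i) ^ 2) / 2 := by
      rw [← sum_alternating_cycle d r, Finset.sum_range]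
      refine Finset.sum_congr rfl fun t _ => ?_
      rw [hrot, hy, hy]
      rfl
    rw [hsum, hlast]
    have he : Even (2 * r) := even_two_mul r
    have e1 : 2 * r / 2 = r := by omega
    simp only [Fin.val_last, he, if_true, hy, e1, Even.zero, Nat.zero_div]
    have hS : 0 ≤ ∑ i ∈ Finset.range r, (d (i + 1) - d i) ^ 2 :=
      Finset.sum_nonneg fun i _ => sq_nonneg _
    by_contra hcon
    have h0 : d 0 ^ 2 ≤ 0 := by nlinarith [sq_nonneg (d r - d 0), sq_nonneg (d 0)]
    have h1 : ∑ i ∈ Finset.range r, (d (i + 1) - d i) ^ 2 ≤ 0 := by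
      nlinarith [sq_nonneg (d r - d 0), sq_nonneg (d 0)]
    have hd0 : d 0 = 0 := pow_eq_zero_iff two_ne_zero |>.1 (le_antisymm h0 (sq_nonneg _))
    have h2 := (Finset.sum_eq_zero_iff_of_nonneg fun i _ => sq_nonneg (d (i + 1) - d i)).1
      (le_antisymm h1 hS)
    have h3 : ∀ i, i ≤ r → d i = 0 := by
      intro i
      induction i with
      | zero => exact fun _ => hd0
      | succ i ih =>
        intro hi
        have h4 := pow_eq_zero_iff two_ne_zero |>.1 (h2 i (Finset.mem_range.2 (by omega)))
        rw [ih (by omega)] at h4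
        linarith
    apply hc
    ext i
    have h4 := h3 i.1 (by omega)
    have h5 : d i.1 = c i := by simp only [d, dl, dif_pos i.2, LinearMap.proj_apply]
    rw [← h5, h4]
    rfl

variable {n m k : ℕ} {A : Matrix (Fin n) (Fin n) Entry}

/-- Put the cycle weights on the edges of the given cycles and zero elsewhere. By disjointness the
form on the combined subspace is a sum of the separate cycle forms, hence negative definite. -/
theorem exists_conforming_of_disjoint_cycles (hA : A.IsSymm) (C : Fin k → DCycle (stateDigraph A))
    (hC : Pairwise fun i j => (C i).Disj (C j)) (B : Matrix (Fin n) (Fin m) ℝ) :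
    ∃ X : Matrix (Fin n) (Fin n) ℝ, X.IsSymm ∧ Conforms A X ∧
      ∑ i, ((C i).len + 1) / 2 ≤ Module.finrank ℝ (stabilizableSubspace X B) := by
  choose w Ψ hΨ using fun i => exists_negDef_cycle (C i).len (C i).len_pos
  let E : ∀ i, Fin (C i).len → Matrix (Fin n) (Fin n) ℝ := fun i t =>
    single ((C i).vert t) ((C i).vert (finRotate _ t)) 1 +
      single ((C i).vert (finRotate _ t)) ((C i).vert t) 1
  let X : Matrix (Fin n) (Fin n) ℝ := ∑ i, ∑ t, w i t • E i t
  have hEs : ∀ i t, (E i t)ᵀ = E i t := fun i t => by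
    simp [E, transpose_add, transpose_single, add_comm]
  have hEc : ∀ i t, Conforms A (E i t) := by
    intro i t a b hab
    have hst : A ((C i).vert (finRotate _ t)) ((C i).vert t) = Entry.star := (C i).adj t
    have h1 : ¬ ((C i).vert (finRotate _ t) = a ∧ (C i).vert t = b) := by
      rintro ⟨rfl, rfl⟩; exact hab hst
    have h2 : ¬ ((C i).vert t = a ∧ (C i).vert (finRotate _ t) = b) := by
      rintro ⟨rfl, rfl⟩; exact hab (by rw [hA.apply, hst])
    simp only [E, Matrix.add_apply, Matrix.single_apply, h1, h2, if_false, add_zero]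
  have hXs : X.IsSymm := by
    simp [X, IsSymm, transpose_sum, transpose_smul, hEs]
  have hXc : Conforms A X := by
    intro a b hab
    simp only [X, Matrix.sum_apply, Matrix.smul_apply]
    exact Finset.sum_eq_zero fun i _ => Finset.sum_eq_zero fun t _ => by
      rw [hEc i t a b hab, smul_zero]
  refine ⟨X, hXs, hXc, ?_⟩
  have hQ : ∀ x : Fin n → ℝ, x ⬝ᵥ X *ᵥ x =
      2 * ∑ i, ∑ t, w i t * (x ((C i).vert t) * x ((C i).vert (finRotate _ t))) := by
    intro x
    simp only [X, sum_mulVec, dotProduct_sum, Finset.mul_sum, smul_mulVec, dotProduct_smul]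
    refine Finset.sum_congr rfl fun i _ => Finset.sum_congr rfl fun t _ => ?_
    simp only [E, add_mulVec, dotProduct_add, single_mulVec, one_mul, smul_eq_mul]
    have : ∀ (a : Fin n) (y : ℝ), x ⬝ᵥ Function.update (0 : Fin n → ℝ) a y = x a * y := by
      intro a y
      exact dotProduct_single x y a
    rw [this, this]
    ring
  let Φ : ((Σ i : Fin k, Fin (((C i).len + 1) / 2)) → ℝ) →ₗ[ℝ] (Fin n → ℝ) :=
    ∑ i, ∑ t, (((LinearMap.proj t).comp (Ψ i)).comp
      (LinearMap.funLeft ℝ ℝ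
        (fun s => (⟨i, s⟩ : Σ i : Fin k, Fin (((C i).len + 1) / 2))))).smulRight
          (Pi.single ((C i).vert t) (1 : ℝ))
  have hΦ : ∀ c i t, Φ c ((C i).vert t) = Ψ i (fun s => c ⟨i, s⟩) t := by
    intro c i t
    have h1 : Φ c ((C i).vert t) = ∑ j, ∑ s, Ψ j (fun s => c ⟨j, s⟩) s *
        (Pi.single ((C j).vert s) (1 : ℝ) : Fin n → ℝ) ((C i).vert t) := by
      simp only [Φ, LinearMap.sum_apply, Finset.sum_apply, LinearMap.smulRight_apply,
        Pi.smul_apply, smul_eq_mul]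
      rfl
    rw [h1, Finset.sum_eq_single i, Finset.sum_eq_single t]
    · simp
    · intro s _ hs
      rw [Pi.single_eq_of_ne (fun h => hs ((C i).inj h).symm), mul_zero]
    · simp
    · intro j _ hj
      refine Finset.sum_eq_zero fun s _ => ?_
      rw [Pi.single_eq_of_ne (fun h => Set.disjoint_left.1 (hC hj) ⟨s, rfl⟩ ⟨t, h⟩), mul_zero]
    · simp
  have hneg := finrank_le_finrank_stabilizableSubspace_of_negDef (B := B) hXs Φ (fun c hc => by
    rw [hQ]
    simp only [hΦ]
    refine mul_neg_of_pos_of_neg two_pos (Finset.sum_neg' (fun i _ => ?_) ?_)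
    · by_cases hi : (fun s => c ⟨i, s⟩) = 0
      · simp [hi]
      · exact (hΨ i _ hi).le
    · obtain ⟨⟨i, s⟩, hs⟩ := Function.ne_iff.1 hc
      exact ⟨i, Finset.mem_univ _, hΨ i _ (Function.ne_iff.2 ⟨s, hs⟩)⟩)
  simpa using hneg

end Cycles

/-! ### Additivity over block decompositions -/

section Blocks
variable {n m p q : ℕ}

theorem finrank_stabilizableSubspace_block (e : Fin n ≃ Fin p ⊕ Fin q)
    (X₁ : Matrix (Fin p) (Fin p) ℝ) (X₂ : Matrix (Fin q) (Fin q) ℝ)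
    (Y₁ : Matrix (Fin p) (Fin m) ℝ) :
    Module.finrank ℝ (stabilizableSubspace ((fromBlocks X₁ 0 0 X₂).submatrix e e)
      ((fromRows Y₁ 0).submatrix e id)) =
    Module.finrank ℝ (stabilizableSubspace X₁ Y₁) +
      Module.finrank ℝ (stabilizableSubspace X₂ (0 : Matrix (Fin q) (Fin m) ℝ)) := by
  set X := (fromBlocks X₁ 0 0 X₂).submatrix e e
  set Y := (fromRows Y₁ (0 : Matrix (Fin q) (Fin m) ℝ)).submatrix e id
  have hX : ∀ x, X *ᵥ x = (fromBlocks X₁ 0 0 X₂ *ᵥ (x ∘ e.symm)) ∘ e :=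
    fun x => submatrix_mulVec_equiv _ x e e
  have hY : ∀ u, Y *ᵥ u = (fromRows Y₁ (0 : Matrix (Fin q) (Fin m) ℝ) *ᵥ u) ∘ e :=
    fun u => rfl
  let Φ : (Fin n → ℝ) ≃ₗ[ℝ] (Fin p → ℝ) × (Fin q → ℝ) :=
    (LinearEquiv.funCongrLeft ℝ ℝ e.symm).trans
      (LinearEquiv.sumArrowLequivProdArrow (Fin p) (Fin q) ℝ ℝ)
  have hΦ₁ : ∀ x a, (Φ x).1 a = x (e.symm (Sum.inl a)) := fun _ _ => rfl
  have hΦ₂ : ∀ x a, (Φ x).2 a = x (e.symm (Sum.inr a)) := fun _ _ => rfl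
  have hΦs : ∀ z, Φ.symm z = Sum.elim z.1 z.2 ∘ e := by
    intro z
    rw [LinearEquiv.symm_apply_eq]
    ext a <;> simp [hΦ₁, hΦ₂]
  have h1 : stabilizableSubspace X Y ≤ (stabilizableSubspace X₁ Y₁).comap
      ((LinearMap.fst ℝ _ _).comp Φ.toLinearMap) := by
    refine stabilizableSubspace_le_comap _ LinearMap.id fun x u => ?_
    ext a
    simp only [LinearMap.comp_apply, LinearEquiv.coe_coe, LinearMap.fst_apply, hΦ₁, Pi.add_apply,
      hX, hY, Function.comp_apply, Equiv.apply_symm_apply, fromBlocks_mulVec, fromRows_mulVec,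
      Sum.elim_inl, zero_mulVec, add_zero, LinearMap.id_apply]
    rfl
  have h2 : stabilizableSubspace X Y ≤
      (stabilizableSubspace X₂ (0 : Matrix (Fin q) (Fin m) ℝ)).comap
        ((LinearMap.snd ℝ _ _).comp Φ.toLinearMap) := by
    refine stabilizableSubspace_le_comap _ (LinearMap.id : (Fin m → ℝ) →ₗ[ℝ] _) fun x u => ?_
    ext a
    simp only [LinearMap.comp_apply, LinearEquiv.coe_coe, LinearMap.snd_apply, hΦ₂, Pi.add_apply,
      hX, hY, Function.comp_apply, Equiv.apply_symm_apply, fromBlocks_mulVec, fromRows_mulVec,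
      Sum.elim_inr, zero_mulVec, zero_add, Pi.zero_apply]
    rfl
  have h3 : stabilizableSubspace X₁ Y₁ ≤ (stabilizableSubspace X Y).comap
      (Φ.symm.toLinearMap.comp (LinearMap.inl ℝ _ _)) := by
    refine stabilizableSubspace_le_comap _ LinearMap.id fun x u => ?_
    simp only [LinearMap.comp_apply, LinearEquiv.coe_coe, LinearMap.inl_apply, hΦs,
      hX, hY, LinearMap.id_apply]
    ext i
    rcases hi : e i with a | a <;>
      simp [hi, fromBlocks_mulVec, fromRows_mulVec, Function.comp_assoc]
  have h4 : stabilizableSubspace X₂ (0 : Matrix (Fin q) (Fin m) ℝ) ≤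
      (stabilizableSubspace X Y).comap (Φ.symm.toLinearMap.comp (LinearMap.inr ℝ _ _)) := by
    refine stabilizableSubspace_le_comap _ (0 : (Fin m → ℝ) →ₗ[ℝ] (Fin m → ℝ)) fun x u => ?_
    simp only [LinearMap.comp_apply, LinearEquiv.coe_coe, LinearMap.inr_apply, hΦs,
      hX, hY, LinearMap.zero_apply]
    ext i
    rcases hi : e i with a | a <;>
      simp [hi, fromBlocks_mulVec, Function.comp_assoc]
  have heq : stabilizableSubspace X Y =
      ((stabilizableSubspace X₁ Y₁).prod
        (stabilizableSubspace X₂ (0 : Matrix (Fin q) (Fin m) ℝ))).comap Φ.toLinearMap := by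
    refine le_antisymm (fun x hx => ⟨h1 hx, h2 hx⟩) fun x hx => ?_
    have h5 : x = Φ.symm ((Φ x).1, 0) + Φ.symm (0, (Φ x).2) := by
      rw [← map_add, Prod.mk_add_mk, add_zero, zero_add, LinearEquiv.symm_apply_apply]
    rw [h5]
    exact Submodule.add_mem _ (h3 hx.1) (h4 hx.2)
  let P := (stabilizableSubspace X₁ Y₁).prod
    (stabilizableSubspace X₂ (0 : Matrix (Fin q) (Fin m) ℝ))
  have hmap : (stabilizableSubspace X Y).map Φ.toLinearMap = P := by
    rw [heq]
    exact Submodule.map_comap_eq_of_surjective Φ.surjective _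
  let Θ : P ≃ₗ[ℝ] stabilizableSubspace X₁ Y₁ ×
      stabilizableSubspace X₂ (0 : Matrix (Fin q) (Fin m) ℝ) :=
    { toFun := fun z => (⟨z.1.1, z.2.1⟩, ⟨z.1.2, z.2.2⟩)
      invFun := fun z => ⟨(z.1.1, z.2.1), z.1.2, z.2.2⟩
      map_add' := fun _ _ => rfl
      map_smul' := fun _ _ => rfl }
  rw [← LinearEquiv.finrank_map_eq Φ (stabilizableSubspace X Y), ← Module.finrank_prod,
    ← Θ.finrank_eq, ← hmap]

end Blocks

/-! ### Closed sets of states, block forms and the two bounds -/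

section BlockForms
variable {n m : ℕ} {A : Matrix (Fin n) (Fin n) Entry} {B : Matrix (Fin n) (Fin m) Entry}

theorem Entry.eq_zero_of_ne_star {x : Entry} (h : x ≠ Entry.star) : x = 0 := by
  cases x
  · rfl
  · exact absurd rfl h

theorem Entry.zero_ne_star : (0 : Entry) ≠ Entry.star := fun h => Entry.noConfusion h

/-- Being closed excludes stars from `Z` to its complement; symmetry of `A` excludes them in the
other direction too. -/
theorem exists_isBlockForm_of_isClosedStates (hA : A.IsSymm) {Z : Set (Fin n)}
    (hZ : IsClosedStates A B Z) (hne : Z ≠ Set.univ) :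
    ∃ (p q : ℕ) (e : Fin n ≃ Fin p ⊕ Fin q) (A₁₁ : Matrix (Fin p) (Fin p) Entry)
      (A₂₂ : Matrix (Fin q) (Fin q) Entry) (B₁ : Matrix (Fin p) (Fin m) Entry),
      IsBlockForm A B e A₁₁ A₂₂ B₁ ∧ ∀ i, i ∈ Z ↔ (e i).isLeft := by
  classical
  let e : Fin n ≃ Fin (Fintype.card Z) ⊕ Fin (Fintype.card (Zᶜ : Set (Fin n))) :=
    (Equiv.Set.sumCompl Z).symm.trans
      (Equiv.sumCongr (Fintype.equivFin Z) (Fintype.equivFin (Zᶜ : Set (Fin n))))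
  have hl : ∀ a, e.symm (Sum.inl a) ∈ Z := fun a => by simp [e]
  have hr : ∀ a, e.symm (Sum.inr a) ∉ Z := fun a => by
    have := ((Fintype.equivFin (Zᶜ : Set (Fin n))).symm a).2
    exact this
  have hleft : ∀ i, i ∈ Z ↔ (e i).isLeft := by
    intro i
    obtain ⟨a | a, rfl⟩ := e.symm.surjective i
    · simp [hl]
    · simp [hr]
  refine ⟨_, _, e, (reindex e e A).toBlocks₁₁, (reindex e e A).toBlocks₂₂,
    (reindex e (Equiv.refl (Fin m)) B).toRows₁, ⟨?_, ?_, ?_⟩, hleft⟩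
  · rw [Fintype.card_pos_iff]
    obtain ⟨x, hx⟩ := (Set.ne_univ_iff_exists_notMem _).1 hne
    exact ⟨⟨x, hx⟩⟩
  · ext (a | a) (b | b)
    · rfl
    · exact Entry.eq_zero_of_ne_star fun h => hr b (hZ.step _ _ (by
        rw [← h, reindex_apply, submatrix_apply, hA.apply]) (hl a))
    · exact Entry.eq_zero_of_ne_star fun h => hr a (hZ.step _ _ h (hl b))
    · rfl
  · ext (a | a) j
    · rfl
    · exact Entry.eq_zero_of_ne_star fun h => hr a (hZ.input _ _ h)

theorem isClosedStates_inputReachable (A : Matrix (Fin n) (Fin n) Entry)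
    (B : Matrix (Fin n) (Fin m) Entry) : IsClosedStates A B {i | InputReachable A B i} where
  input i j h := ⟨j, Relation.ReflTransGen.single h⟩
  step i j h := by
    rintro ⟨k, hk⟩
    exact ⟨k, hk.tail h⟩

theorem InputReachable.mem_of_isClosedStates {i : Fin n} (h : InputReachable A B i)
    {Z : Set (Fin n)} (hZ : IsClosedStates A B Z) : i ∈ Z := by
  obtain ⟨j, hj⟩ := h
  have key : ∀ v, Relation.ReflTransGen (sysDigraph A B).Adj (Sum.inr j) v →
      ∀ i, v = Sum.inl i → i ∈ Z := by
    intro v hv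
    induction hv with
    | refl => intro i hi; cases hi
    | @tail b c hb hbc ih =>
      rintro i rfl
      rcases b with b | b
      · exact hZ.step i b hbc (ih b rfl)
      · exact hZ.input i b hbc
  exact key _ hj i rfl

variable {p q : ℕ} {e : Fin n ≃ Fin p ⊕ Fin q} {A₁₁ : Matrix (Fin p) (Fin p) Entry}
  {A₂₂ : Matrix (Fin q) (Fin q) Entry} {B₁ : Matrix (Fin p) (Fin m) Entry}

theorem IsBlockForm.apply_eq (h : IsBlockForm A B e A₁₁ A₂₂ B₁) (a b : Fin p ⊕ Fin q) :
    A (e.symm a) (e.symm b) = fromBlocks A₁₁ 0 0 A₂₂ a b :=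
  congrFun (congrFun h.2.1 a) b

theorem IsBlockForm.input_apply_eq (h : IsBlockForm A B e A₁₁ A₂₂ B₁) (a : Fin p ⊕ Fin q)
    (j : Fin m) : B (e.symm a) j = fromRows B₁ 0 a j :=
  congrFun (congrFun h.2.2 a) j

theorem IsBlockForm.isSymm (h : IsBlockForm A B e A₁₁ A₂₂ B₁) (hA : A.IsSymm) :
    A₁₁.IsSymm ∧ A₂₂.IsSymm := by
  constructor <;> ext a b
  · have h1 := h.apply_eq (Sum.inl a) (Sum.inl b)
    rw [← hA.apply, h.apply_eq] at h1
    exact h1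
  · have h1 := h.apply_eq (Sum.inr a) (Sum.inr b)
    rw [← hA.apply, h.apply_eq] at h1
    exact h1

theorem IsBlockForm.card_eq (_ : IsBlockForm A B e A₁₁ A₂₂ B₁) : n = p + q := by
  simpa using Fintype.card_congr e

/-- A closed set of the first block is closed in the whole system, since the off-diagonal blocks
vanish, so it contains every input-reachable state. -/
theorem IsBlockForm.eq_univ_of_isClosedStates (h : IsBlockForm A B e A₁₁ A₂₂ B₁)
    (hreach : ∀ i, InputReachable A B i ↔ (e i).isLeft) (Z : Set (Fin p))
    (hZ : IsClosedStates A₁₁ B₁ Z) : Z = Set.univ := by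
  have hcl : IsClosedStates A B {i | ∃ a ∈ Z, i = e.symm (Sum.inl a)} := by
    constructor
    · intro i j hij
      obtain ⟨a | a, rfl⟩ := e.symm.surjective i
      · rw [h.input_apply_eq] at hij
        exact ⟨a, hZ.input a j hij, rfl⟩
      · rw [h.input_apply_eq] at hij
        exact absurd hij Entry.zero_ne_star
    · rintro i _ hij ⟨b, hb, rfl⟩
      obtain ⟨a | a, rfl⟩ := e.symm.surjective i
      · rw [h.apply_eq] at hij
        exact ⟨a, hZ.step a b hij hb, rfl⟩
      · rw [h.apply_eq] at hij
        exact absurd hij Entry.zero_ne_star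
  refine Set.eq_univ_of_forall fun a => ?_
  have h1 : InputReachable A B (e.symm (Sum.inl a)) := (hreach _).2 (by simp)
  obtain ⟨b, hb, hab⟩ := h1.mem_of_isClosedStates hcl
  rwa [Sum.inl_injective (e.symm.injective hab)]

/-- Realize the blocks separately. Reachability of the first block is essential: an unreachable pair
of states joined only by opposite edges would add `2` to the term rank but at most `1` to the
stabilizable dimension. -/
theorem IsBlockForm.le_mDim (h : IsBlockForm A B e A₁₁ A₂₂ B₁) (hA : A.IsSymm)
    (hreach : ∀ i, InputReachable A B i ↔ (e i).isLeft) {k : ℕ}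
    (C : Fin k → DCycle (stateDigraph A₂₂)) (hC : Pairwise fun i j => (C i).Disj (C j)) :
    tRank (fromCols A₁₁ B₁) + ∑ i, ((C i).len + 1) / 2 ≤ mDim A B := by
  obtain ⟨hA₁, hA₂⟩ := h.isSymm hA
  obtain ⟨p₁, q₁, hr⟩ := exists_tRank_le_rank_ctrbMatrix hA₁ (h.eq_univ_of_isClosedStates hreach)
  obtain ⟨X₂, hX₂s, hX₂, hd⟩ := exists_conforming_of_disjoint_cycles hA₂ C hC
    (0 : Matrix (Fin q) (Fin m) ℝ)
  have hXs : ((fromBlocks (realizeSym A₁₁ p₁) 0 0 X₂).submatrix e e).IsSymm :=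
    (IsSymm.fromBlocks (realizeSym_isSymm hA₁ p₁) (by simp) hX₂s).submatrix e
  have hX : Conforms A ((fromBlocks (realizeSym A₁₁ p₁) 0 0 X₂).submatrix e e) := by
    intro i j hij
    obtain ⟨a, rfl⟩ := e.symm.surjective i
    obtain ⟨b, rfl⟩ := e.symm.surjective j
    rw [h.apply_eq] at hij
    rw [submatrix_apply, Equiv.apply_symm_apply, Equiv.apply_symm_apply]
    rcases a with a | a <;> rcases b with b | b
    · exact realizeSym_conforms _ _ a b hij
    · rfl
    · rfl
    · exact hX₂ a b hij
  have hY : Conforms B ((fromRows (realize B₁ q₁) 0).submatrix e id) := by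
    intro i j hij
    obtain ⟨a, rfl⟩ := e.symm.surjective i
    rw [h.input_apply_eq] at hij
    rw [submatrix_apply, Equiv.apply_symm_apply]
    rcases a with a | a
    · exact realize_conforms _ _ a j hij
    · rfl
  obtain ⟨p', hp'⟩ := hX.exists_realizeSym hXs
  obtain ⟨q', hq'⟩ := hY.exists_realize
  have h1 := (mDim_isGreatest A B).2 ⟨p', q', rfl⟩
  rw [hp', hq', finrank_stabilizableSubspace_block] at h1
  exact (add_le_add (hr.trans rank_ctrbMatrix_le_finrank_stabilizableSubspace) hd).trans h1

/-- Split an optimal realization along the blocks: the range of `[A₁₁, B₁]` bounds the first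
summand, and the isotropic subspace spanned by `S` bounds the second. -/
theorem IsBlockForm.mDim_add_card_le (h : IsBlockForm A B e A₁₁ A₂₂ B₁) (hA : A.IsSymm)
    {S : Finset (Fin q)} (hS : IsIndep (stateDigraph A₂₂) S) :
    mDim A B + S.card ≤ tRank (fromCols A₁₁ B₁) + q := by
  obtain ⟨p', q', hd⟩ := (mDim_isGreatest A B).1
  set X := realizeSym A p' with hXdef
  set Y := realize B q' with hYdef
  let X' := X.submatrix e.symm e.symm
  let Y' := Y.submatrix e.symm id
  have hX' : ∀ a b, fromBlocks A₁₁ 0 0 A₂₂ a b ≠ Entry.star → X' a b = 0 := fun a b hab =>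
    realizeSym_conforms A p' _ _ (by rwa [h.apply_eq])
  have hY' : ∀ a j, fromRows B₁ 0 a j ≠ Entry.star → Y' a j = 0 := fun a j hab =>
    realize_conforms B q' _ _ (by rwa [h.input_apply_eq])
  have hX : X = (fromBlocks X'.toBlocks₁₁ 0 0 X'.toBlocks₂₂).submatrix e e := by
    ext i j
    obtain ⟨a, rfl⟩ := e.symm.surjective i
    obtain ⟨b, rfl⟩ := e.symm.surjective j
    rw [submatrix_apply, Equiv.apply_symm_apply, Equiv.apply_symm_apply]
    rcases a with a | a <;> rcases b with b | b
    · rfl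
    · exact hX' _ _ Entry.zero_ne_star
    · exact hX' _ _ Entry.zero_ne_star
    · rfl
  have hY : Y = (fromRows Y'.toRows₁ 0).submatrix e id := by
    ext i j
    obtain ⟨a, rfl⟩ := e.symm.surjective i
    rw [submatrix_apply, Equiv.apply_symm_apply]
    rcases a with a | a
    · rfl
    · exact hY' _ _ Entry.zero_ne_star
  have hX₁ : Conforms A₁₁ X'.toBlocks₁₁ := fun a b hab => hX' (Sum.inl a) (Sum.inl b) hab
  have hY₁ : Conforms B₁ Y'.toRows₁ := fun a j hab => hY' (Sum.inl a) j hab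
  have hX₂ : X'.toBlocks₂₂.IsSymm := by
    ext a b
    exact (realizeSym_isSymm hA p').apply _ _
  have h1 := finrank_stabilizableSubspace_le_of_isotropic (m := m) hX₂ S
    fun i hi j hj => hX' (Sum.inr i) (Sum.inr j) (hS j hj i hi)
  have h2 := (finrank_stabilizableSubspace_le_rank (A := X'.toBlocks₁₁) (B := Y'.toRows₁)).trans
    (hX₁.fromCols hY₁).rank_le_tRank
  rw [hX, hY, finrank_stabilizableSubspace_block] at hd
  omega

theorem half_sum_even_add_half_sum_odd {k : ℕ} (l : Fin k → ℕ) :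
    1 / 2 * ∑ i with Even (l i), (l i : ℝ) + 1 / 2 * ∑ i with Odd (l i), ((l i : ℝ) + 1) =
      ((∑ i, (l i + 1) / 2 : ℕ) : ℝ) := by
  rw [Finset.sum_filter, Finset.sum_filter, ← mul_add, ← Finset.sum_add_distrib, Finset.mul_sum,
    Nat.cast_sum]
  refine Finset.sum_congr rfl fun i _ => ?_
  rcases Nat.even_or_odd' (l i) with ⟨r, hr | hr⟩
  · have h1 : (l i + 1) / 2 = r := by omega
    have h2 : Even (l i) := ⟨r, by omega⟩
    rw [h1, if_pos h2, if_neg (Nat.not_odd_iff_even.2 h2), hr]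
    push_cast
    ring
  · have h1 : (l i + 1) / 2 = r + 1 := by omega
    have h2 : Odd (l i) := ⟨r, hr⟩
    rw [h1, if_neg (Nat.not_even_iff_odd.2 h2), if_pos h2, hr]
    push_cast
    ring

end BlockForms

end StructSys

/-! ### The main theorem -/

theorem theorem2 (n m : ℕ) (A : Matrix (Fin n) (Fin n) Entry) (B : Matrix (Fin n) (Fin m) Entry)
    (hA : A.IsSymm) :
    -- irreducible pairs: the generic dimension exists, is unique, and equals the maximum dimension
    (IsIrreduciblePair A B → ∀ d : ℕ, IsGenericCtrbDim A B d ↔ d = mDim A B) ∧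
    (¬ IsIrreduciblePair A B →
      -- there is a block form whose first block consists of the input-reachable states
      (∃ (p q : ℕ) (e : Fin n ≃ Fin p ⊕ Fin q) (A₁₁ : Matrix (Fin p) (Fin p) Entry)
        (A₂₂ : Matrix (Fin q) (Fin q) Entry) (B₁ : Matrix (Fin p) (Fin m) Entry),
        IsBlockForm A B e A₁₁ A₂₂ B₁ ∧ ∀ i, InputReachable A B i ↔ (e i).isLeft) ∧
      ∀ (p q : ℕ) (e : Fin n ≃ Fin p ⊕ Fin q) (A₁₁ : Matrix (Fin p) (Fin p) Entry)
        (A₂₂ : Matrix (Fin q) (Fin q) Entry) (B₁ : Matrix (Fin p) (Fin m) Entry),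
        IsBlockForm A B e A₁₁ A₂₂ B₁ →
        -- lower bound
        ((∀ i, InputReachable A B i ↔ (e i).isLeft) →
          ∀ (k : ℕ) (C : Fin k → DCycle (stateDigraph A₂₂)),
            (Pairwise fun i j => (C i).Disj (C j)) →
            (tRank (Matrix.fromCols A₁₁ B₁) : ℝ)
                + 1 / 2 * ∑ i with Even (C i).len, ((C i).len : ℝ)
                + 1 / 2 * ∑ i with Odd (C i).len, (((C i).len : ℝ) + 1)
              ≤ (mDim A B : ℝ)) ∧
        -- upper bound
        (∀ S : Finset (Fin q), IsMaximumIndep (stateDigraph A₂₂) S →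
          (mDim A B : ℝ)
            ≤ (tRank (Matrix.fromCols A₁₁ B₁) : ℝ) + ((n : ℝ) - (p : ℝ)) - (S.card : ℝ))) := by
  refine ⟨fun hirr => ?_, fun hred => ⟨?_, ?_⟩⟩
  · have hcl : ∀ Z : Set (Fin n), IsClosedStates A B Z → Z = Set.univ := by
      intro Z hZ
      by_contra hne
      obtain ⟨p, q, e, A₁₁, A₂₂, B₁, h, -⟩ := exists_isBlockForm_of_isClosedStates hA hZ hne
      exact hirr ⟨p, q, e, A₁₁, A₂₂, B₁, h⟩
    intro d
    rw [isGenericCtrbDim_iff hA hcl, mDim_eq_tRank hA hcl]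
  · refine exists_isBlockForm_of_isClosedStates hA (isClosedStates_inputReachable A B) ?_
    obtain ⟨p, q, e, A₁₁, A₂₂, B₁, h⟩ := not_not.1 hred
    intro huniv
    have h1 : InputReachable A B (e.symm (Sum.inr ⟨0, h.1⟩)) :=
      (huniv ▸ Set.mem_univ _ : _ ∈ {i | InputReachable A B i})
    -- The first block of any block form is closed, so it contains all input-reachable states; since
    -- `q > 0`, some state is not reachable.
    have hcl : IsClosedStates A B {i | (e i).isLeft} := by
      constructor
      · intro i j hij
        obtain ⟨a | a, rfl⟩ := e.symm.surjective i
        · simp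
        · rw [h.input_apply_eq] at hij
          exact absurd hij Entry.zero_ne_star
      · intro i j hij hj
        obtain ⟨a | a, rfl⟩ := e.symm.surjective i
        · simp
        · obtain ⟨b | b, rfl⟩ := e.symm.surjective j
          · rw [h.apply_eq] at hij
            exact absurd hij Entry.zero_ne_star
          · simp at hj
    have h2 := h1.mem_of_isClosedStates hcl
    simp at h2
  · intro p q e A₁₁ A₂₂ B₁ h
    refine ⟨fun hreach k C hC => ?_, fun S hS => ?_⟩
    · rw [add_assoc, half_sum_even_add_half_sum_odd]
      exact_mod_cast h.le_mDim hA hreach C hC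
    · have h1 := h.mDim_add_card_le hA hS.1
      have h2 : (n : ℝ) = p + q := by exact_mod_cast h.card_eq
      have h3 : (mDim A B : ℝ) + S.card ≤ tRank (Matrix.fromCols A₁₁ B₁) + q := by
        exact_mod_cast h1
      rw [h2]
      linarith
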